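/- Let $c_0>0$, let $D\subset\mathbb{R}^3$ be a bounded open set, and let $q_c:D\to\mathbb{R}$ be measurable with $0\le q_c\le q_{c,+}<\infty$ a.e. in $D$, and such that $v=0$ whenever $v\in L^2(D)$ and $\|q_c^{1/2}v\|_{L^2(D)}=0$. Let $L^2_{q_c}(D)$ be the space with norm $\|u\|_{L^2_{q_c}(D)}^2=\int_D q_c|u|^2\,dx$. For $s\in\mathbb{C}$ with $\sigma:=\Re(s)>0$ let $$(\hat V f)(x)=\int_D \frac{e^{-s\|x-y\|/c_0}}{4\pi\|x-y\|}\,f(y)\,dy,\qquad x\in\mathbb{R}^3,$$ and let $\|w\|_{H^1_s(\mathbb{R}^3)}^2=\|\nabla w\|_{L^2(\mathbb{R}^3)}^2+|s|^2\|w\|_{L^2(\mathbb{R}^3)}^2$. Let $\sigma_0>0$. There is a constant $C>0$, depending only on $\sigma_0$, $c_0$ and $q_{c,+}$, such that for every $s$ with $\sigma=\Re(s)>\sigma_0$ and every $\hat u^i\in L^2_{q_c}(D)$ the equation $$\hat u+\frac{s^2}{c_0^2}\hat V(q_c\hat u)=\frac{s^2}{c_0^2}\hat V(q_c\hat u^i)\quad\text{in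 }L^2_{q_c}(D)$$ has a unique solution $\hat u\in L^2_{q_c}(D)$. Extended from $D$ to $\mathbb{R}^3$ by this equation, that is, by $\hat u:=\frac{s^2}{c_0^2}\hat V(q_c\hat u^i)-\frac{s^2}{c_0^2}\hat V(q_c\hat u)$, it belongs to $H^1_s(\mathbb{R}^3)$; moreover $\hat u|_D\in H^2(D)$, and $$\|\hat u\|_{L^2_{q_c}(D)}\le \frac{q_{c,+}}{\sigma^2}|s|^2\,\|\hat u^i\|_{L^2_{q_c}(D)},$$ $$\|\hat u\|_{H^1_s(\mathbb{R}^3)}\le \max\Big(1,\frac1{c_0}\Big)\frac{|s|^2}{\sigma}\,q_{c,+}^{1/2}\Big(1+\frac{q_{c,+}}{\sigma^2}|s|^2\Big)\|\hat u^i\|_{L^2_{q_c}(D)},$$ $$\|\hat u\|_{H^2(D)}\le C|s|^5\,\|\hat u^i\|_{L^2_{q_c}(D)}.$$ -/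

import Mathlib

open MeasureTheory

open scoped ContDiff ENNReal

namespace LippmannSchwinger

/-- Three-dimensional Euclidean space. -/
abbrev R3 : Type := EuclideanSpace ℝ (Fin 3)

/-- The fundamental solution `exp (-s ‖x - y‖ / c₀) / (4 π ‖x - y‖)` of the operator
`-Δ + s ^ 2 / c₀ ^ 2` (its value on the null set `x = y` plays no role). -/
noncomputable def fundSol (c₀ : ℝ) (s : ℂ) (x y : R3) : ℂ :=
  Complex.exp (-s * (‖x - y‖ : ℂ) / (c₀ : ℂ)) / (4 * (Real.pi : ℂ) * (‖x - y‖ : ℂ))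

/-- The Laplace-domain volume potential of a density `f` on `D`. When `D` is bounded and `f` is
square integrable on `D`, the integral converges absolutely at every `x`. -/
noncomputable def volPot (c₀ : ℝ) (s : ℂ) (D : Set R3) (f : R3 → ℂ) (x : R3) : ℂ :=
  ∫ y in D, fundSol c₀ s x y * f y

/-- The measure `q dx` on `D`. -/
noncomputable def weightedMeasure (D : Set R3) (q : R3 → ℝ) : Measure R3 :=
  (volume.restrict D).withDensity (fun x => ENNReal.ofReal (q x))

/-- The weighted space `L²_q(D)`, with `‖u‖ ^ 2 = ∫_D q |u| ^ 2`. -/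
noncomputable abbrev L2q (D : Set R3) (q : R3 → ℝ) : Type :=
  Lp ℂ 2 (weightedMeasure D q)

/-- The product `q u` of the contrast and a complex function. -/
noncomputable def qmul (q : R3 → ℝ) (u : R3 → ℂ) (x : R3) : ℂ := (q x : ℂ) * u x

/-- `u` solves `u + (s² / c₀²) V (q u) = (s² / c₀²) V (q uinc)` in `L²_q(D)`. -/
def IsSolution (c₀ : ℝ) (s : ℂ) (D : Set R3) (q : R3 → ℝ) (uinc u : L2q D q) : Prop :=
  ∀ᵐ x ∂(weightedMeasure D q),
    u x + s ^ 2 / (c₀ : ℂ) ^ 2 * volPot c₀ s D (qmul q u) x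
      = s ^ 2 / (c₀ : ℂ) ^ 2 * volPot c₀ s D (qmul q uinc) x

/-- The function on the whole space into which the integral equation extends a solution `u`
given on `D`: `(s² / c₀²) V (q uinc) - (s² / c₀²) V (q u)`. -/
noncomputable def solExt (c₀ : ℝ) (s : ℂ) (D : Set R3) (q : R3 → ℝ) (uinc u : L2q D q)
    (x : R3) : ℂ :=
  s ^ 2 / (c₀ : ℂ) ^ 2 * volPot c₀ s D (qmul q uinc) x
    - s ^ 2 / (c₀ : ℂ) ^ 2 * volPot c₀ s D (qmul q u) x

/-- `g` is the weak partial derivative of `u` in the `i`-th coordinate direction on `Ω`. -/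
def IsWeakPartial (Ω : Set R3) (i : Fin 3) (u g : R3 → ℂ) : Prop :=
  LocallyIntegrableOn u Ω volume ∧ LocallyIntegrableOn g Ω volume ∧
    ∀ φ : R3 → ℝ, ContDiff ℝ ∞ φ → HasCompactSupport φ → tsupport φ ⊆ Ω →
      ∫ x in Ω, (fderiv ℝ φ x (EuclideanSpace.single i (1 : ℝ))) • u x
        = -∫ x in Ω, φ x • g x

/-- Weak partial derivatives on an open set are unique almost everywhere. -/
theorem IsWeakPartial.ae_eq {Ω : Set R3} (hΩ : IsOpen Ω) {i : Fin 3} {u g h : R3 → ℂ}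
    (hg : IsWeakPartial Ω i u g) (hh : IsWeakPartial Ω i u h) :
    g =ᵐ[volume.restrict Ω] h := by
  have key : ∀ᵐ x ∂(volume : Measure R3), x ∈ Ω → (g - h) x = 0 := by
    refine hΩ.ae_eq_zero_of_integral_contDiff_smul_eq_zero (hg.2.1.sub hh.2.1) ?_
    intro φ hφ hc hs
    have int : ∀ f : R3 → ℂ, LocallyIntegrableOn f Ω volume →
        Integrable (fun x => φ x • f x) (volume.restrict Ω) := by
      intro f hf
      have h1 : IntegrableOn f (tsupport φ) volume :=
        hf.integrableOn_compact_subset hs hc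
      have h2 : IntegrableOn (fun x => φ x • f x) (tsupport φ) volume :=
        h1.continuousOn_smul hφ.continuous.continuousOn hc
      have h3 : Integrable (fun x => φ x • f x) volume := by
        refine (integrableOn_iff_integrable_of_support_subset ?_).1 h2
        intro x hx
        refine subset_tsupport φ ?_
        intro h0
        exact hx (by simp [h0])
      exact h3.integrableOn
    have e := (hg.2.2 φ hφ hc hs).symm.trans (hh.2.2 φ hφ hc hs)
    have e2 : ∫ x in Ω, φ x • g x = ∫ x in Ω, φ x • h x := neg_injective e
    have e3 : ∫ x in Ω, φ x • (g - h) x = 0 := by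
      simp only [Pi.sub_apply, smul_sub]
      rw [integral_sub (int g hg.2.1) (int h hh.2.1), e2, sub_self]
    rw [← e3]
    symm
    refine setIntegral_eq_integral_of_forall_compl_eq_zero ?_
    intro x hx
    have h0 : φ x = 0 := image_eq_zero_of_notMem_tsupport (fun hx' => hx (hs hx'))
    simp [h0]
  refine (ae_restrict_iff' hΩ.measurableSet).2 ?_
  filter_upwards [key] with x hx hxΩ
  exact sub_eq_zero.1 (hx hxΩ)

open Classical in
/-- The weak partial derivative, unique almost everywhere on an open set (`0` if there is none). -/
noncomputable def weakPartial (Ω : Set R3) (i : Fin 3) (u : R3 → ℂ) : R3 → ℂ :=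
  if h : ∃ g, IsWeakPartial Ω i u g then h.choose else 0

/-- The Sobolev space `H¹(Ω)`. -/
def MemH1 (Ω : Set R3) (u : R3 → ℂ) : Prop :=
  MemLp u 2 (volume.restrict Ω) ∧
    ∀ i, ∃ g, IsWeakPartial Ω i u g ∧ MemLp g 2 (volume.restrict Ω)

/-- The Sobolev space `H²(Ω)`: the function and its first weak derivatives lie in `H¹(Ω)`. -/
def MemH2 (Ω : Set R3) (u : R3 → ℂ) : Prop :=
  MemH1 Ω u ∧ ∀ i, MemH1 Ω (weakPartial Ω i u)

/-- The square of the `L²(Ω)` norm. -/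
noncomputable def l2Sq (Ω : Set R3) (u : R3 → ℂ) : ℝ := ∫ x in Ω, ‖u x‖ ^ 2

/-- The `s`-dependent norm `(‖∇u‖² + |s|² ‖u‖²)^(1/2)` of `H¹_s(Ω)`. -/
noncomputable def h1sNorm (s : ℂ) (Ω : Set R3) (u : R3 → ℂ) : ℝ :=
  Real.sqrt ((∑ i, l2Sq Ω (weakPartial Ω i u)) + ‖s‖ ^ 2 * l2Sq Ω u)

/-- The norm of `H²(Ω)`. -/
noncomputable def h2Norm (Ω : Set R3) (u : R3 → ℂ) : ℝ :=
  Real.sqrt (l2Sq Ω u + (∑ i, l2Sq Ω (weakPartial Ω i u))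
    + ∑ i, ∑ j, l2Sq Ω (weakPartial Ω j (weakPartial Ω i u)))

end LippmannSchwinger

namespace LippmannSchwinger

open FourierTransform SchwartzMap LineDeriv

open scoped BoundedContinuousFunction

/-! Put κ = s / c₀. The volume potential is convolution with the Yukawa kernel, whose Fourier
transform is 1 / (4π²|ξ|² + κ²) (`fourier_kern`), so on L² it is the resolvent R = (-Δ + κ²)⁻¹
(`convolution_kern_ae_eq`). Let M u = 1_D q u, from L²_q(D) to L²(ℝ³). Its adjoint is restriction to
D, so the equation reads (1 + T) u = T uinc with T = κ² M* R M.

Everything rests on the identity Re(κ̄ (r + κ²)) = Re κ (r + |κ|²), used with r = 4π²|ξ|². It bounds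
the symbol of R, giving ‖R‖ ≤ 1 / (Re κ |κ|), and it also gives Re(κ̄ ⟨u, T u⟩) ≥ 0. Hence 1 + T is
coercive with constant Re κ / |κ|, so it is invertible. Together with ‖M‖ ≤ √Q this yields the bound
in L²_q(D).

The extended solution is R applied to κ² M (uinc - u). Its weak derivatives are Fourier multipliers
of degree at most two divided by the symbol of R⁻¹, and pointwise bounds on these symbols give the
H¹ and H² estimates. -/

/-- Square integrable functions on `ℝ³`. -/
abbrev L2R3 : Type := Lp ℂ 2 (volume : Measure R3)

/-! ### Fourier transforms on L¹ and L², and weak derivatives -/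

theorem Lp.integral_schwartz_smul_fourier (W : L2R3) (g : 𝓢(R3, ℂ)) :
    ∫ x, g x • (𝓕 W : L2R3) x = ∫ x, 𝓕 g x • W x := by
  have h := Lp.fourier_toTemperedDistribution_eq W
  have h2 := congrArg (fun T : 𝓢'(R3, ℂ) => T g) h
  simp only [TemperedDistribution.fourier_apply, Lp.toTemperedDistribution_apply] at h2
  exact h2.symm

theorem integral_schwartz_smul_fourier {f : R3 → ℂ} (hf : Integrable f) (g : 𝓢(R3, ℂ)) :
    ∫ x, g x • 𝓕 f x = ∫ x, 𝓕 g x • f x := by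
  have := VectorFourier.integral_fourierIntegral_smul_eq_flip (L := innerₗ R3)
    Real.continuous_fourierChar continuous_inner (g.integrable (μ := volume)) hf
  simp only [flip_innerₗ] at this
  rw [SchwartzMap.fourier_coe]
  exact this.symm

theorem ae_eq_of_forall_schwartz {f h : R3 → ℂ} (hf : LocallyIntegrable f)
    (hh : LocallyIntegrable h)
    (H : ∀ g : 𝓢(R3, ℂ), ∫ x, g x • f x = ∫ x, g x • h x) : f =ᵐ[volume] h := by
  refine ae_eq_of_integral_contDiff_smul_eq hf hh ?_
  intro g hg hc
  have hc' : HasCompactSupport (fun x => (g x : ℂ)) :=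
    hc.comp_left (g := fun r : ℝ => (r : ℂ)) (by simp)
  simp only [← Complex.coe_smul]
  exact H (hc'.toSchwartzMap (Complex.ofRealCLM.contDiff.comp hg))

theorem Lp.locallyIntegrable_two (W : L2R3) : LocallyIntegrable W volume :=
  (Lp.memLp W).locallyIntegrable (by norm_num)

/-- The integral transform on L¹ and the Plancherel transform on L² obey the same multiplication
formula against Schwartz functions; testing with `𝓕⁻ g` transfers equality back. This compares a
convolution, handled in L¹, with a multiplier operator on L². -/
theorem ae_eq_of_fourier_ae_eq {f : R3 → ℂ} (hf : Integrable f) (W : L2R3)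
    (h : 𝓕 f =ᵐ[volume] (𝓕 W : L2R3)) : f =ᵐ[volume] W := by
  refine ae_eq_of_forall_schwartz hf.locallyIntegrable (Lp.locallyIntegrable_two W) ?_
  intro g
  have h1 := integral_schwartz_smul_fourier hf (𝓕⁻ g)
  have h2 := Lp.integral_schwartz_smul_fourier W (𝓕⁻ g)
  rw [fourier_fourierInv_eq] at h1 h2
  rw [← h1, ← h2]
  refine integral_congr_ae ?_
  filter_upwards [h] with x hx
  rw [hx]

theorem continuous_fourier_of_integrable {f : R3 → ℂ} (hf : Integrable f) : Continuous (𝓕 f) :=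
  VectorFourier.fourierIntegral_continuous Real.continuous_fourierChar
    (L := innerₗ R3) continuous_inner hf

theorem fourier_ae_eq_of_ae_eq {f : R3 → ℂ} (hf : Integrable f) (W : L2R3)
    (h : f =ᵐ[volume] W) : 𝓕 f =ᵐ[volume] (𝓕 W : L2R3) := by
  refine ae_eq_of_forall_schwartz (continuous_fourier_of_integrable hf).locallyIntegrable
    (Lp.locallyIntegrable_two _) ?_
  intro g
  rw [integral_schwartz_smul_fourier hf, Lp.integral_schwartz_smul_fourier]
  refine integral_congr_ae ?_
  filter_upwards [h] with x hx
  rw [hx]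

/-- The Fourier transform is injective on tempered distributions and turns the directional
derivative into multiplication by the symbol in the hypothesis. -/
theorem lineDeriv_toTemperedDistribution_eq {W V : L2R3} {m : R3}
    (h : ∀ᵐ ξ, (𝓕 V : L2R3) ξ = 2 * Real.pi * Complex.I * (inner ℝ ξ m : ℝ) * (𝓕 W : L2R3) ξ) :
    ∂_{m} (W : 𝓢'(R3, ℂ)) = V := by
  have key : 𝓕 (∂_{m} (W : 𝓢'(R3, ℂ))) = 𝓕 (V : 𝓢'(R3, ℂ)) := by
    rw [TemperedDistribution.fourier_lineDerivOp_eq, Lp.fourier_toTemperedDistribution_eq,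
      Lp.fourier_toTemperedDistribution_eq]
    ext g
    have hm : (fun ξ : R3 => (inner ℝ ξ m : ℝ)).HasTemperateGrowth := by fun_prop
    simp only [smul_apply, TemperedDistribution.smulLeftCLM_apply_apply,
      Lp.toTemperedDistribution_apply]
    rw [← integral_smul]
    refine integral_congr_ae ?_
    filter_upwards [h] with ξ hξ
    rw [hξ, SchwartzMap.smulLeftCLM_apply_apply (by fun_prop)]
    simp only [smul_eq_mul]
    ring
  have := congrArg (fun T => 𝓕⁻ T) key
  simpa using this

/-- Multiplication by `2 π i ξ_i` on the Fourier side is the weak partial derivative. -/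
theorem isWeakPartial_of_fourier {W V : L2R3} {i : Fin 3}
    (h : ∀ᵐ ξ, (𝓕 V : L2R3) ξ = 2 * Real.pi * Complex.I * (ξ i : ℝ) * (𝓕 W : L2R3) ξ) :
    IsWeakPartial Set.univ i W V := by
  refine ⟨(Lp.locallyIntegrable_two W).locallyIntegrableOn _,
    (Lp.locallyIntegrable_two V).locallyIntegrableOn _, ?_⟩
  intro φ hφ hc _
  have hd : ∂_{EuclideanSpace.single i (1 : ℝ)} (W : 𝓢'(R3, ℂ)) = V := by
    refine lineDeriv_toTemperedDistribution_eq ?_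
    filter_upwards [h] with ξ hξ
    rw [hξ, EuclideanSpace.inner_single_right]
    simp
  have hc' : HasCompactSupport (fun x => (φ x : ℂ)) :=
    hc.comp_left (g := fun r : ℝ => (r : ℂ)) (by simp)
  have hs : ContDiff ℝ ∞ (fun x => (φ x : ℂ)) := Complex.ofRealCLM.contDiff.comp hφ
  have h2 := congrArg (fun T : 𝓢'(R3, ℂ) => T (hc'.toSchwartzMap hs)) hd
  simp only [TemperedDistribution.lineDerivOp_apply_apply, Lp.toTemperedDistribution_apply] at h2
  simp only [Measure.restrict_univ]
  have h3 : ∀ x, (∂_{EuclideanSpace.single i (1 : ℝ)} (hc'.toSchwartzMap hs)) x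
      = ((fderiv ℝ φ x (EuclideanSpace.single i (1 : ℝ)) : ℝ) : ℂ) := by
    intro x
    rw [SchwartzMap.lineDerivOp_apply_eq_fderiv]
    have : HasFDerivAt (fun x => (φ x : ℂ)) (Complex.ofRealCLM.comp (fderiv ℝ φ x)) x :=
      Complex.ofRealCLM.hasFDerivAt.comp x (hφ.differentiable (by simp) x).hasFDerivAt
    have h4 := this.fderiv
    exact congrArg (fun L => L (EuclideanSpace.single i (1 : ℝ))) h4
  simp only [neg_apply, h3, neg_smul, integral_neg] at h2
  simp only [← Complex.coe_smul]
  rw [← neg_eq_iff_eq_neg, h2]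
  rfl

/-! ### The Yukawa kernel and its Fourier transform -/

/-- The Yukawa kernel `exp (-κ ‖z‖) / (4 π ‖z‖)`. -/
noncomputable def kern (κ : ℂ) (z : R3) : ℂ :=
  Complex.exp (-κ * (‖z‖ : ℂ)) / (4 * (Real.pi : ℂ) * (‖z‖ : ℂ))

/-- The Yukawa kernel as a function of the distance. -/
noncomputable def radialKern (κ : ℂ) (r : ℝ) : ℂ :=
  Complex.exp (-κ * (r : ℂ)) / (4 * (Real.pi : ℂ) * (r : ℂ))

theorem norm_cexp_neg_mul_ofReal (κ : ℂ) (r : ℝ) :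
    ‖Complex.exp (-κ * (r : ℂ))‖ = Real.exp (-κ.re * r) := by
  simp [Complex.norm_exp]

/-- In polar coordinates the Jacobian r² absorbs the singularity 1/r, leaving a multiple of r
exp(-Re κ r). -/
theorem integrable_kern {κ : ℂ} (hκ : 0 < κ.re) : Integrable (kern κ) := by
  have : Integrable (fun z : R3 => radialKern κ ‖z‖) := by
    rw [integrable_fun_norm_addHaar volume (f := radialKern κ)]
    have h1 := integrableOn_rpow_mul_exp_neg_mul_rpow (p := 1) (s := 1) (by norm_num) one_pos hκ
    refine Integrable.mono' h1 ?_ ?_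
    · refine ContinuousOn.aestronglyMeasurable ?_ measurableSet_Ioi
      unfold radialKern
      refine ContinuousOn.fun_smul (continuous_id.pow _).continuousOn
        (ContinuousOn.div (by fun_prop) (by fun_prop) ?_)
      intro x hx
      have hx : (x : ℂ) ≠ 0 := by exact_mod_cast (ne_of_gt hx : x ≠ 0)
      have : (Real.pi : ℂ) ≠ 0 := by exact_mod_cast Real.pi_ne_zero
      simp [hx, this]
    · refine (ae_restrict_iff' measurableSet_Ioi).2 (Filter.Eventually.of_forall fun r hr => ?_)
      have hr : 0 < r := hr
      have hpi := Real.pi_gt_three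
      rw [norm_smul, radialKern, norm_div, norm_cexp_neg_mul_ofReal]
      simp only [finrank_euclideanSpace, Fintype.card_fin, Nat.add_one_sub_one, norm_pow,
        Real.norm_eq_abs, abs_of_pos hr, norm_mul, Complex.norm_real, Real.rpow_one,
        abs_of_pos Real.pi_pos, Complex.norm_ofNat]
      rw [mul_div_assoc', div_le_iff₀ (by positivity)]
      have := Real.exp_pos (-κ.re * r)
      have h2 : 0 ≤ r ^ 2 * Real.exp (-κ.re * r) := by positivity
      nlinarith
  exact this

/-- Cartesian coordinates of `ℝ³`, the first one split off. -/
noncomputable def splitEquiv : R3 ≃ᵐ ℝ × (ℝ × ℝ) :=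
  ((MeasurableEquiv.toLp 2 (Fin 3 → ℝ)).symm.trans
    (MeasurableEquiv.piFinSuccAbove (fun _ => ℝ) 0)).trans
    ((MeasurableEquiv.refl ℝ).prodCongr MeasurableEquiv.finTwoArrow)

theorem splitEquiv_apply (x : R3) : splitEquiv x = (x 0, (x 1, x 2)) := rfl

theorem measurePreserving_splitEquiv : MeasurePreserving splitEquiv := by
  refine MeasurePreserving.trans (MeasurePreserving.trans (PiLp.volume_preserving_ofLp (Fin 3))
    (volume_preserving_piFinSuccAbove (fun _ => ℝ) 0)) ?_
  exact (MeasurePreserving.id volume).prod (volume_preserving_finTwoArrow ℝ)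

theorem norm_splitEquiv_symm (z : ℝ) (p : ℝ × ℝ) :
    ‖splitEquiv.symm (z, p)‖ = Real.sqrt (z ^ 2 + (p.1 ^ 2 + p.2 ^ 2)) := by
  obtain ⟨x, hx⟩ := splitEquiv.surjective (z, p)
  rw [← hx, MeasurableEquiv.symm_apply_apply]
  rw [splitEquiv_apply] at hx
  have h1 : x 0 = z := congrArg Prod.fst hx
  have h2 : (x 1, x 2) = p := congrArg Prod.snd hx
  subst h1 h2
  rw [EuclideanSpace.norm_eq]
  simp [Fin.sum_univ_three, add_assoc]

theorem splitEquiv_symm_apply_zero (z : ℝ) (p : ℝ × ℝ) : splitEquiv.symm (z, p) 0 = z := by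
  obtain ⟨x, hx⟩ := splitEquiv.surjective (z, p)
  rw [← hx, MeasurableEquiv.symm_apply_apply]
  exact congrArg Prod.fst hx

/-- The integrand is an exact derivative, of -exp(-κ √(z² + r²)) / (4πκ). The condition z ≠ 0 keeps
the square root smooth down to r = 0. -/
theorem integral_radialKern_mul {κ : ℂ} (hκ : 0 < κ.re) {z : ℝ} (hz : z ≠ 0) :
    ∫ r in Set.Ioi (0 : ℝ), (r : ℂ) * radialKern κ (Real.sqrt (z ^ 2 + r ^ 2))
      = Complex.exp (-κ * (|z| : ℝ)) / (4 * Real.pi * κ) := by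
  have hpi : (Real.pi : ℂ) ≠ 0 := by exact_mod_cast Real.pi_ne_zero
  have hκ0 : κ ≠ 0 := by rintro rfl; simp at hκ
  have hpos : ∀ r : ℝ, 0 < z ^ 2 + r ^ 2 := fun r => by positivity
  have hsq : ∀ r : ℝ, 0 < Real.sqrt (z ^ 2 + r ^ 2) := fun r => Real.sqrt_pos.2 (hpos r)
  have hle : ∀ r : ℝ, r ≤ Real.sqrt (z ^ 2 + r ^ 2) := fun r =>
    Real.le_sqrt_of_sq_le (by nlinarith [sq_nonneg z])
  have hd : ∀ r ∈ Set.Ici (0 : ℝ), HasDerivAt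
      (fun r : ℝ => -Complex.exp (-κ * (Real.sqrt (z ^ 2 + r ^ 2) : ℝ)) / (4 * Real.pi * κ))
      ((r : ℂ) * radialKern κ (Real.sqrt (z ^ 2 + r ^ 2))) r := by
    intro r _
    have h1 : HasDerivAt (fun r : ℝ => Real.sqrt (z ^ 2 + r ^ 2))
        (r / Real.sqrt (z ^ 2 + r ^ 2)) r := by
      have := (((hasDerivAt_id r).pow 2).const_add (z ^ 2)).sqrt (hpos r).ne'
      convert! this using 1
      simp
      field_simp
    have h2 := (((h1.ofReal_comp).const_mul (-κ)).cexp.neg).div_const (4 * Real.pi * κ)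
    convert! h2 using 1
    have h3 : (Real.sqrt (z ^ 2 + r ^ 2) : ℂ) ≠ 0 := by exact_mod_cast (hsq r).ne'
    unfold radialKern
    push_cast
    field_simp
  have hint : IntegrableOn (fun r : ℝ => (r : ℂ) * radialKern κ (Real.sqrt (z ^ 2 + r ^ 2)))
      (Set.Ioi 0) := by
    refine Integrable.mono' (integrableOn_exp_mul_Ioi (a := -κ.re) (by linarith) 0) ?_ ?_
    · refine ContinuousOn.aestronglyMeasurable ?_ measurableSet_Ioi
      unfold radialKern
      refine ContinuousOn.mul (by fun_prop) (ContinuousOn.div (by fun_prop) (by fun_prop) ?_)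
      intro r _
      have : (Real.sqrt (z ^ 2 + r ^ 2) : ℂ) ≠ 0 := by exact_mod_cast (hsq r).ne'
      simp [this, hpi]
    · refine (ae_restrict_iff' measurableSet_Ioi).2 (Filter.Eventually.of_forall fun r hr => ?_)
      have hr : 0 < r := hr
      have hp3 := Real.pi_gt_three
      rw [norm_mul, radialKern, norm_div, norm_cexp_neg_mul_ofReal]
      simp only [norm_mul, Complex.norm_real, Real.norm_eq_abs, abs_of_pos hr,
        abs_of_pos Real.pi_pos, Complex.norm_ofNat, abs_of_pos (hsq r)]
      rw [mul_div_assoc', div_le_iff₀ (mul_pos (by positivity) (hsq r))]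
      have h1 : Real.exp (-κ.re * Real.sqrt (z ^ 2 + r ^ 2)) ≤ Real.exp (-κ.re * r) :=
        Real.exp_le_exp.2 (by nlinarith [hle r])
      have h2 : r ≤ 4 * Real.pi * Real.sqrt (z ^ 2 + r ^ 2) := by nlinarith [hle r, hsq r]
      calc r * Real.exp (-κ.re * Real.sqrt (z ^ 2 + r ^ 2))
          ≤ (4 * Real.pi * Real.sqrt (z ^ 2 + r ^ 2)) * Real.exp (-κ.re * r) := by gcongr
        _ = _ := by ring
  have hlim : Filter.Tendsto
      (fun r : ℝ => -Complex.exp (-κ * (Real.sqrt (z ^ 2 + r ^ 2) : ℝ)) / (4 * Real.pi * κ))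
      Filter.atTop (nhds 0) := by
    have h1 : Filter.Tendsto (fun r : ℝ => Complex.exp (-κ * (Real.sqrt (z ^ 2 + r ^ 2) : ℝ)))
        Filter.atTop (nhds 0) := by
      rw [Complex.tendsto_exp_nhds_zero_iff]
      have h2 : Filter.Tendsto (fun r : ℝ => Real.sqrt (z ^ 2 + r ^ 2)) Filter.atTop
          Filter.atTop := Filter.tendsto_atTop_mono hle Filter.tendsto_id
      have := h2.const_mul_atTop_of_neg (r := -κ.re) (by linarith)
      simpa using this
    simpa using (h1.neg).div_const (4 * Real.pi * κ)
  have := integral_Ioi_of_hasDerivAt_of_tendsto' hd hint hlim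
  rw [this]
  have h0 : Real.sqrt (z ^ 2 + 0 ^ 2) = |z| := by
    rw [zero_pow two_ne_zero, add_zero, Real.sqrt_sq_eq_abs]
  rw [h0]
  ring

theorem integral_plane_radialKern {κ : ℂ} (hκ : 0 < κ.re) {z : ℝ} (hz : z ≠ 0) :
    ∫ p : ℝ × ℝ, radialKern κ (Real.sqrt (z ^ 2 + (p.1 ^ 2 + p.2 ^ 2)))
      = Complex.exp (-κ * (|z| : ℝ)) / (2 * κ) := by
  have hpi : (Real.pi : ℂ) ≠ 0 := by exact_mod_cast Real.pi_ne_zero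
  have hκ0 : κ ≠ 0 := by rintro rfl; simp at hκ
  calc ∫ p : ℝ × ℝ, radialKern κ (Real.sqrt (z ^ 2 + (p.1 ^ 2 + p.2 ^ 2)))
      -- The trailing factor 1 is the angular integrand, so that the integral splits as a product;
      -- it contributes 2π.
      = ∫ p in polarCoord.target, (p.1 : ℂ) * radialKern κ (Real.sqrt (z ^ 2 + p.1 ^ 2))
          * 1 := by
        rw [← integral_comp_polarCoord_symm]
        congr with p
        simp only [polarCoord_symm_apply, mul_pow, Complex.real_smul, mul_one]
        rw [← mul_add, Real.cos_sq_add_sin_sq, mul_one]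
    _ = (∫ r in Set.Ioi (0 : ℝ), (r : ℂ) * radialKern κ (Real.sqrt (z ^ 2 + r ^ 2)))
          * ∫ θ in Set.Ioo (-Real.pi) Real.pi, (1 : ℂ) := by
        rw [← setIntegral_prod_mul]
        rfl
    _ = _ := by
        rw [integral_radialKern_mul hκ hz]
        simp only [integral_const, measureReal_restrict_apply, MeasurableSet.univ,
          Set.univ_inter, Complex.real_smul, mul_one]
        rw [Real.volume_real_Ioo_of_le (by linarith [Real.pi_pos])]
        push_cast
        field_simp
        ring

/-- On each half-line the integrand is a pure exponential. With b = 2πia the two pieces add up by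
partial fractions to 1 / (κ² - b²). -/
theorem integral_fourier_exp_neg_abs {κ : ℂ} (hκ : 0 < κ.re) (a : ℝ) :
    ∫ z : ℝ, Complex.exp (-(2 * Real.pi * z * a : ℝ) * Complex.I)
        * (Complex.exp (-κ * (|z| : ℝ)) / (2 * κ))
      = 1 / (4 * Real.pi ^ 2 * a ^ 2 + κ ^ 2) := by
  have hκ0 : κ ≠ 0 := by rintro rfl; simp at hκ
  set b : ℂ := (2 * Real.pi * a : ℝ) * Complex.I with hb
  have hbre : b.re = 0 := by simp [hb]
  have hm : (-b - κ).re < 0 := by simp [hbre, hκ]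
  have hp : 0 < (-b + κ).re := by simp [hbre, hκ]
  have e1 : Set.EqOn (fun z : ℝ => (1 / (2 * κ)) * Complex.exp ((-b + κ) * z))
      (fun z : ℝ => Complex.exp (-(2 * Real.pi * z * a : ℝ) * Complex.I)
        * (Complex.exp (-κ * (|z| : ℝ)) / (2 * κ))) (Set.Iic 0) := by
    intro z hz
    have hz : z ≤ 0 := hz
    simp only
    rw [abs_of_nonpos hz, mul_div_assoc', ← Complex.exp_add, div_mul_eq_mul_div, one_mul]
    congr 2
    simp only [hb]
    push_cast
    ring
  have e2 : Set.EqOn (fun z : ℝ => (1 / (2 * κ)) * Complex.exp ((-b - κ) * z))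
      (fun z : ℝ => Complex.exp (-(2 * Real.pi * z * a : ℝ) * Complex.I)
        * (Complex.exp (-κ * (|z| : ℝ)) / (2 * κ))) (Set.Ioi 0) := by
    intro z hz
    have hz : 0 < z := hz
    simp only
    rw [abs_of_pos hz, mul_div_assoc', ← Complex.exp_add, div_mul_eq_mul_div, one_mul]
    congr 2
    simp only [hb]
    push_cast
    ring
  have i1 := IntegrableOn.congr_fun
    ((integrableOn_exp_mul_complex_Iic hp 0).const_mul (1 / (2 * κ))) e1 measurableSet_Iic
  have i2 := IntegrableOn.congr_fun
    ((integrableOn_exp_mul_complex_Ioi hm 0).const_mul (1 / (2 * κ))) e2 measurableSet_Ioi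
  rw [← intervalIntegral.integral_Iic_add_Ioi i1 i2, ← setIntegral_congr_fun measurableSet_Iic e1,
    ← setIntegral_congr_fun measurableSet_Ioi e2, integral_const_mul, integral_const_mul,
    integral_exp_mul_complex_Iic hp, integral_exp_mul_complex_Ioi hm]
  have h1 : -b + κ ≠ 0 := fun h => by rw [h] at hp; simp at hp
  have h2 : b + κ ≠ 0 := fun h => by
    have : (-b - κ) = 0 := by linear_combination -h
    rw [this] at hm; simp at hm
  have h4 : -b - κ = -(b + κ) := by ring
  have h3 : (4 * Real.pi ^ 2 * a ^ 2 + κ ^ 2 : ℂ) = (-b + κ) * (b + κ) := by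
    have : b ^ 2 = -(4 * Real.pi ^ 2 * a ^ 2) := by
      rw [hb, mul_pow, Complex.I_sq]; push_cast; ring
    linear_combination this
  rw [h3, h4]
  simp only [Complex.ofReal_zero, mul_zero, Complex.exp_zero]
  field_simp
  ring

/-- For a frequency on the first axis the phase depends on the first coordinate only, so Fubini
reduces the transform to the plane integral and then to one variable. -/
theorem fourier_kern_axis {κ : ℂ} (hκ : 0 < κ.re) (a : ℝ) :
    𝓕 (kern κ) (EuclideanSpace.single 0 a) = 1 / (4 * Real.pi ^ 2 * a ^ 2 + κ ^ 2) := by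
  rw [Real.fourier_eq']
  set F : R3 → ℂ := fun v =>
    Complex.exp ((-2 * Real.pi * inner ℝ v (EuclideanSpace.single 0 a) : ℝ) * Complex.I) • kern κ v
    with hF
  have hFi : Integrable F := by
    refine (integrable_kern hκ).bdd_mul (c := 1) ?_ ?_
    · exact (by fun_prop : Continuous _).aestronglyMeasurable
    · refine Filter.Eventually.of_forall fun v => ?_
      rw [Complex.norm_exp_ofReal_mul_I]
  have hmp := measurePreserving_splitEquiv.symm splitEquiv
  have hi : Integrable (fun x => F (splitEquiv.symm x)) :=
    (hmp.integrable_comp_emb splitEquiv.symm.measurableEmbedding).2 hFi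
  rw [← hmp.integral_comp splitEquiv.symm.measurableEmbedding F,
    Measure.volume_eq_prod, integral_prod _ hi, ← integral_fourier_exp_neg_abs hκ a]
  refine integral_congr_ae ?_
  have h0 : ∀ᵐ z : ℝ, z ≠ 0 := by simp [ae_iff]
  filter_upwards [h0] with z hz
  rw [← integral_plane_radialKern hκ hz, ← integral_const_mul]
  congr with p
  simp only [hF, EuclideanSpace.inner_single_right, splitEquiv_symm_apply_zero, smul_eq_mul]
  congr 1
  · congr 2
    simp
    ring
  · rw [kern, norm_splitEquiv_symm, radialKern]

/-- The Fourier transform of the Yukawa kernel. -/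
theorem fourier_kern {κ : ℂ} (hκ : 0 < κ.re) (ξ : R3) :
    𝓕 (kern κ) ξ = 1 / (4 * Real.pi ^ 2 * (‖ξ‖ : ℂ) ^ 2 + κ ^ 2) := by
  have hn : ‖(EuclideanSpace.single 0 ‖ξ‖ : R3)‖ = ‖ξ‖ := by simp
  -- The reflection exchanging two vectors of equal norm carries the axis to ξ; the kernel is
  -- radial, so its transform is invariant under it.
  have hA := Submodule.reflection_sub hn
  set A := Submodule.reflection (Submodule.span ℝ {(EuclideanSpace.single 0 ‖ξ‖ : R3) - ξ})ᗮ
  have hk : kern κ ∘ A = kern κ := by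
    ext x
    simp [kern, A.norm_map]
  have := Real.fourier_comp_linearIsometry A (kern κ) (EuclideanSpace.single 0 ‖ξ‖)
  rw [hA, hk] at this
  rw [← this, fourier_kern_axis hκ]

/-! ### Fourier multipliers on L² -/

theorem memLp_bounded_mul (m : R3 →ᵇ ℂ) (f : L2R3) :
    MemLp (fun ξ => m ξ * f ξ) 2 volume :=
  (Lp.memLp f).of_le_mul (m.continuous.aestronglyMeasurable.mul (Lp.memLp f).1) (c := ‖m‖)
    (Filter.Eventually.of_forall fun ξ => by
      rw [norm_mul]; gcongr; exact m.norm_coe_le_norm ξ)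

/-- Multiplication by a bounded continuous function on `L²(ℝ³)`. -/
noncomputable def mulL2 (m : R3 →ᵇ ℂ) : L2R3 →L[ℂ] L2R3 :=
  LinearMap.mkContinuous
    { toFun := fun f => (memLp_bounded_mul m f).toLp
      map_add' := fun f g => by
        rw [← MemLp.toLp_add]
        refine MemLp.toLp_congr _ _ ?_
        filter_upwards [Lp.coeFn_add f g] with ξ hξ
        rw [hξ, Pi.add_apply, Pi.add_apply, mul_add]
      map_smul' := fun c f => by
        rw [RingHom.id_apply, ← MemLp.toLp_const_smul]
        refine MemLp.toLp_congr _ _ ?_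
        filter_upwards [Lp.coeFn_smul c f] with ξ hξ
        simp [hξ, mul_left_comm] }
    ‖m‖ fun f => by
      refine Lp.norm_le_mul_norm_of_ae_le_mul ?_
      filter_upwards [(memLp_bounded_mul m f).coeFn_toLp] with ξ hξ
      change ‖((memLp_bounded_mul m f).toLp : L2R3) ξ‖ ≤ _
      rw [hξ, norm_mul]
      gcongr
      exact m.norm_coe_le_norm ξ

theorem coeFn_mulL2 (m : R3 →ᵇ ℂ) (f : L2R3) :
    mulL2 m f =ᵐ[volume] fun ξ => m ξ * f ξ :=
  (memLp_bounded_mul m f).coeFn_toLp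

theorem norm_mulL2_le {m : R3 →ᵇ ℂ} {C : ℝ} (hC : ∀ ξ, ‖m ξ‖ ≤ C) (f : L2R3) :
    ‖mulL2 m f‖ ≤ C * ‖f‖ := by
  refine Lp.norm_le_mul_norm_of_ae_le_mul ?_
  filter_upwards [coeFn_mulL2 m f] with ξ hξ
  rw [hξ, norm_mul]
  gcongr
  exact hC ξ

theorem l2Sq_univ_eq_norm_sq (f : L2R3) : l2Sq Set.univ f = ‖f‖ ^ 2 := by
  rw [l2Sq, Measure.restrict_univ]
  have h := L2.inner_def (𝕜 := ℂ) f f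
  rw [inner_self_eq_norm_sq_to_K] at h
  simp only [inner_self_eq_norm_sq_to_K] at h
  have h2 : ((‖f‖ ^ 2 : ℝ) : ℂ) = ((∫ x, ‖f x‖ ^ 2 : ℝ) : ℂ) := by
    rw [← integral_complex_ofReal]
    simpa using h
  exact_mod_cast h2.symm

theorem integrable_norm_sq (f : L2R3) : Integrable (fun x => ‖f x‖ ^ 2) :=
  (memLp_two_iff_integrable_sq_norm (Lp.memLp f).1).1 (Lp.memLp f)

/-- The symbols are bounded jointly at each frequency, not one at a time; this gives the energy
estimate its sharp constant. -/
theorem sum_mul_norm_sq_mulL2_le {ι : Type*} [Fintype ι] {c : ι → ℝ} {m : ι → (R3 →ᵇ ℂ)}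
    {K : ℝ} (hK : ∀ ξ, ∑ i, c i * ‖m i ξ‖ ^ 2 ≤ K) (f : L2R3) :
    ∑ i, c i * ‖mulL2 (m i) f‖ ^ 2 ≤ K * ‖f‖ ^ 2 := by
  simp only [← l2Sq_univ_eq_norm_sq, l2Sq, Measure.restrict_univ, ← integral_const_mul]
  rw [← integral_finsetSum _ fun i _ => (integrable_norm_sq _).const_mul _]
  refine integral_mono_ae (integrable_finsetSum _ fun i _ => (integrable_norm_sq _).const_mul _)
    ((integrable_norm_sq f).const_mul K) ?_
  have : ∀ᵐ ξ, ∀ i, mulL2 (m i) f ξ = m i ξ * f ξ := ae_all_iff.2 fun i => coeFn_mulL2 (m i) f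
  filter_upwards [this] with ξ hξ
  simp only [hξ, norm_mul, mul_pow, ← mul_assoc, ← Finset.sum_mul]
  gcongr
  exact hK ξ

theorem re_mul_inner_mulL2_nonneg {m : R3 →ᵇ ℂ} {a : ℂ} (h : ∀ ξ, 0 ≤ (a * m ξ).re)
    (f : L2R3) : 0 ≤ (a * inner ℂ f (mulL2 m f)).re := by
  rw [L2.inner_def, ← integral_const_mul]
  have hi : Integrable fun ξ => a * inner ℂ (f ξ) (mulL2 m f ξ) :=
    (L2.integrable_inner f (mulL2 m f)).const_mul a
  change 0 ≤ RCLike.re (∫ ξ, a * inner ℂ (f ξ) (mulL2 m f ξ))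
  rw [← integral_re hi]
  refine integral_nonneg_of_ae ?_
  filter_upwards [coeFn_mulL2 m f] with ξ hξ
  rw [hξ]
  have : a * inner ℂ (f ξ) (m ξ * f ξ) = (a * m ξ) * ((‖f ξ‖ ^ 2 : ℝ) : ℂ) := by
    rw [← smul_eq_mul (m ξ), inner_smul_right, inner_self_eq_norm_sq_to_K]
    push_cast
    simp [mul_assoc]
  simp only [Pi.zero_apply, this]
  change 0 ≤ ((a * m ξ) * ((‖f ξ‖ ^ 2 : ℝ) : ℂ)).re
  rw [Complex.re_mul_ofReal]
  exact mul_nonneg (h ξ) (sq_nonneg _)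

/-- The Fourier multiplier with symbol `m` on `L²(ℝ³)`. -/
noncomputable def fourierMul (m : R3 →ᵇ ℂ) : L2R3 →L[ℂ] L2R3 :=
  ((Lp.fourierTransformₗᵢ R3 ℂ).symm : L2R3 →L[ℂ] L2R3) ∘L mulL2 m ∘L
    ((Lp.fourierTransformₗᵢ R3 ℂ) : L2R3 →L[ℂ] L2R3)

theorem fourier_fourierMul (m : R3 →ᵇ ℂ) (f : L2R3) :
    (𝓕 (fourierMul m f) : L2R3) = mulL2 m (𝓕 f) :=
  (Lp.fourierTransformₗᵢ R3 ℂ).apply_symm_apply _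

theorem norm_fourierMul (m : R3 →ᵇ ℂ) (f : L2R3) :
    ‖fourierMul m f‖ = ‖mulL2 m (𝓕 f)‖ := by
  rw [← fourier_fourierMul, Lp.norm_fourier_eq]

theorem norm_fourierMul_le {m : R3 →ᵇ ℂ} {C : ℝ} (hC : ∀ ξ, ‖m ξ‖ ≤ C) (f : L2R3) :
    ‖fourierMul m f‖ ≤ C * ‖f‖ := by
  rw [norm_fourierMul, ← Lp.norm_fourier_eq f]
  exact norm_mulL2_le hC _

theorem re_mul_inner_fourierMul_nonneg {m : R3 →ᵇ ℂ} {a : ℂ} (h : ∀ ξ, 0 ≤ (a * m ξ).re)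
    (f : L2R3) : 0 ≤ (a * inner ℂ f (fourierMul m f)).re := by
  rw [← Lp.inner_fourier_eq, fourier_fourierMul]
  exact re_mul_inner_mulL2_nonneg h _

theorem isWeakPartial_fourierMul {m n : R3 →ᵇ ℂ} {i : Fin 3}
    (h : ∀ ξ, n ξ = 2 * Real.pi * Complex.I * (ξ i : ℝ) * m ξ) (f : L2R3) :
    IsWeakPartial Set.univ i (fourierMul m f) (fourierMul n f) := by
  refine isWeakPartial_of_fourier ?_
  rw [fourier_fourierMul, fourier_fourierMul]
  filter_upwards [coeFn_mulL2 m (𝓕 f), coeFn_mulL2 n (𝓕 f)] with ξ h1 h2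
  rw [h1, h2, h ξ]
  ring

/-! ### The resolvent of the Laplacian -/

/-- The quantity `4 π² |ξ|²`, the symbol of `-Δ`. -/
noncomputable def lapSymbol (ξ : R3) : ℝ := 4 * Real.pi ^ 2 * ‖ξ‖ ^ 2

theorem lapSymbol_nonneg (ξ : R3) : 0 ≤ lapSymbol ξ := by unfold lapSymbol; positivity

/-- The coercivity estimate behind all bounds. -/
theorem re_mul_le_norm_mul {κ : ℂ} (r : ℝ) :
    κ.re * (r + ‖κ‖ ^ 2) ≤ ‖κ‖ * ‖(r : ℂ) + κ ^ 2‖ := by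
  -- The factor κ̄ turns κ² into |κ|² κ, whose real part is positive.
  have h : ((starRingEnd ℂ) κ * ((r : ℂ) + κ ^ 2)).re = κ.re * (r + ‖κ‖ ^ 2) := by
    rw [Complex.sq_norm, Complex.normSq_apply]
    simp [pow_two]
    ring
  rw [← h, ← RCLike.norm_conj κ, ← norm_mul]
  exact Complex.re_le_norm _

theorem norm_pos_of_re_pos {κ : ℂ} (hκ : 0 < κ.re) : 0 < ‖κ‖ :=
  hκ.trans_le (Complex.re_le_norm κ)

theorem norm_resolvent_pos {κ : ℂ} {r : ℝ} (hr : 0 ≤ r) (hκ : 0 < κ.re) :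
    0 < ‖(r : ℂ) + κ ^ 2‖ := by
  have h := re_mul_le_norm_mul (κ := κ) r
  have h1 := norm_pos_of_re_pos hκ
  have h2 : 0 < κ.re * (r + ‖κ‖ ^ 2) := by positivity
  exact pos_of_mul_pos_right (h2.trans_le h) h1.le

theorem norm_resolvent_le {κ : ℂ} {r : ℝ} (hr : 0 ≤ r) (hκ : 0 < κ.re) :
    ‖(1 : ℂ) / ((r : ℂ) + κ ^ 2)‖ ≤ ‖κ‖ / (κ.re * (r + ‖κ‖ ^ 2)) := by
  have h1 := norm_pos_of_re_pos hκ
  rw [norm_div, norm_one, div_le_div_iff₀ (norm_resolvent_pos hr hκ) (by positivity), one_mul]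
  exact re_mul_le_norm_mul (κ := κ) r

/-- A polynomial of degree at most two divided by the symbol of `-Δ + κ²`. -/
noncomputable def resolventMul (κ : ℂ) (hκ : 0 < κ.re) (p : R3 → ℂ) (hp : Continuous p)
    (hb : ∀ ξ, ‖p ξ‖ ≤ 1 + lapSymbol ξ) : R3 →ᵇ ℂ :=
  BoundedContinuousFunction.ofNormedAddCommGroup
    (fun ξ => p ξ * (1 / ((lapSymbol ξ : ℂ) + κ ^ 2)))
    (by
      refine hp.mul (continuous_const.div (by unfold lapSymbol; fun_prop) fun ξ => ?_)
      exact norm_pos_iff.1 (norm_resolvent_pos (lapSymbol_nonneg ξ) hκ))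
    -- The coercivity estimate, combined with (1 + r) / (r + |κ|²) ≤ 1 + 1 / |κ|² for r ≥ 0.
    (‖κ‖ / κ.re * (1 + 1 / ‖κ‖ ^ 2))
    (fun ξ => by
      have h0 := lapSymbol_nonneg ξ
      have h1 := norm_pos_of_re_pos hκ
      calc ‖p ξ * (1 / ((lapSymbol ξ : ℂ) + κ ^ 2))‖
          ≤ (1 + lapSymbol ξ) * (‖κ‖ / (κ.re * (lapSymbol ξ + ‖κ‖ ^ 2))) := by
            rw [norm_mul]
            exact mul_le_mul (hb ξ) (norm_resolvent_le h0 hκ) (norm_nonneg _) (by positivity)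
        _ = ‖κ‖ / κ.re * ((1 + lapSymbol ξ) / (lapSymbol ξ + ‖κ‖ ^ 2)) := by
            field_simp
        _ ≤ _ := by
            refine mul_le_mul_of_nonneg_left ?_ (by positivity)
            rw [div_le_iff₀ (by positivity)]
            have : (1 + 1 / ‖κ‖ ^ 2) * (lapSymbol ξ + ‖κ‖ ^ 2)
              = lapSymbol ξ + ‖κ‖ ^ 2 + lapSymbol ξ / ‖κ‖ ^ 2 + 1 := by
              field_simp
              ring
            rw [this]
            have : 0 ≤ lapSymbol ξ / ‖κ‖ ^ 2 := by positivity
            nlinarith [sq_nonneg ‖κ‖])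

section Resolvent

variable {κ : ℂ} (hκ : 0 < κ.re) {p : R3 → ℂ} (hp : Continuous p)
  (hb : ∀ ξ, ‖p ξ‖ ≤ 1 + lapSymbol ξ)

theorem resolventMul_apply (ξ : R3) :
    resolventMul κ hκ p hp hb ξ = p ξ * (1 / ((lapSymbol ξ : ℂ) + κ ^ 2)) := rfl

theorem norm_resolventMul_le (ξ : R3) :
    ‖resolventMul κ hκ p hp hb ξ‖ ≤ ‖κ‖ / κ.re * (1 + 1 / ‖κ‖ ^ 2) := by
  refine (BoundedContinuousFunction.norm_coe_le_norm _ ξ).trans ?_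
  have h1 := norm_pos_of_re_pos hκ
  exact BoundedContinuousFunction.norm_ofNormedAddCommGroup_le _ (by positivity) _

end Resolvent

/-- The operator `(-Δ + κ²)⁻¹` on `L²(ℝ³)`. -/
noncomputable def resolvent (κ : ℂ) (hκ : 0 < κ.re) : L2R3 →L[ℂ] L2R3 :=
  fourierMul (resolventMul κ hκ (fun _ => 1) continuous_const
    (fun ξ => by simpa using lapSymbol_nonneg ξ))

theorem norm_resolvent_apply_le {κ : ℂ} (hκ : 0 < κ.re) (f : L2R3) :
    ‖resolvent κ hκ f‖ ≤ 1 / (κ.re * ‖κ‖) * ‖f‖ := by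
  refine norm_fourierMul_le (fun ξ => ?_) f
  have h0 := lapSymbol_nonneg ξ
  have h1 := norm_pos_of_re_pos hκ
  rw [resolventMul_apply, one_mul]
  refine (norm_resolvent_le h0 hκ).trans ?_
  rw [div_le_div_iff₀ (by positivity) (by positivity)]
  nlinarith [mul_nonneg hκ.le h0]

/-- After multiplying by the conjugate of the denominator, the symbol κ̄ κ² / (r + κ²) has numerator
of real part Re κ |κ|² (r + |κ|²) ≥ 0. -/
theorem re_mul_inner_resolvent_nonneg {κ : ℂ} (hκ : 0 < κ.re) (f : L2R3) :
    0 ≤ ((starRingEnd ℂ) κ * κ ^ 2 * inner ℂ f (resolvent κ hκ f)).re := by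
  refine re_mul_inner_fourierMul_nonneg (fun ξ => ?_) f
  have h0 := lapSymbol_nonneg ξ
  rw [resolventMul_apply, one_mul, mul_one_div, Complex.div_re, ← add_div]
  refine div_nonneg ?_ (Complex.normSq_nonneg _)
  have : (((starRingEnd ℂ) κ * κ ^ 2) * (starRingEnd ℂ) ((lapSymbol ξ : ℂ) + κ ^ 2)).re
      = κ.re * Complex.normSq κ * (lapSymbol ξ + Complex.normSq κ) := by
    simp [pow_two, Complex.normSq_apply]
    ring
  have h2 : 0 ≤ κ.re * Complex.normSq κ * (lapSymbol ξ + Complex.normSq κ) := by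
    have := Complex.normSq_nonneg κ
    positivity
  rw [← this, Complex.mul_re, Complex.conj_re, Complex.conj_im] at h2
  linarith

open Convolution in
/-- Convolution with the Yukawa kernel is the resolvent of the Laplacian. -/
theorem convolution_kern_ae_eq {κ : ℂ} (hκ : 0 < κ.re) {f : R3 → ℂ} (hf : Integrable f)
    {F : L2R3} (hF : f =ᵐ[volume] F) :
    (fun x => ∫ y, kern κ (x - y) * f y) =ᵐ[volume] resolvent κ hκ F := by
  have hk := integrable_kern hκ
  have e : (fun x => ∫ y, kern κ (x - y) * f y)
      = f ⋆[ContinuousLinearMap.mul ℂ ℂ, volume] kern κ := by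
    ext x
    simp only [convolution_def, ContinuousLinearMap.mul_apply', mul_comm]
  rw [e]
  refine ae_eq_of_fourier_ae_eq (hf.integrable_convolution _ hk) _ ?_
  rw [resolvent, fourier_fourierMul]
  filter_upwards [coeFn_mulL2 (resolventMul κ hκ (fun _ => 1) continuous_const
    (fun ξ => by simpa using lapSymbol_nonneg ξ)) (𝓕 F), fourier_ae_eq_of_ae_eq hf F hF]
    with ξ h1 h2
  rw [h1, Real.fourier_mul_convolution_eq hf hk, h2, fourier_kern hκ, resolventMul_apply, one_mul,
    mul_comm]
  simp [lapSymbol]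

/-! ### The weighted space and the density operator -/

/-- `q` is a bounded weight on the bounded open set `D` which vanishes only on a null set. -/
structure IsWeight (D : Set R3) (q : R3 → ℝ) (Q : ℝ) : Prop where
  isOpen : IsOpen D
  isBounded : Bornology.IsBounded D
  aemeasurable : AEMeasurable q (volume.restrict D)
  bounds : ∀ᵐ x ∂(volume.restrict D), 0 ≤ q x ∧ q x ≤ Q
  nonneg : 0 ≤ Q
  absolutelyContinuous : volume.restrict D ≪ weightedMeasure D q

theorem isFiniteMeasure_restrict_of_isBounded {D : Set R3} (h : Bornology.IsBounded D) :
    IsFiniteMeasure (volume.restrict D) :=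
  ⟨by simpa using h.measure_lt_top⟩

/-- The hypothesis is tested on the indicator of {q ≤ 0}, which lies in L² because D has finite
measure. The set is therefore null, and almost everywhere statements pass from the weighted measure
back to Lebesgue measure on D. -/
theorem restrict_absolutelyContinuous_weightedMeasure {D : Set R3} {q : R3 → ℝ}
    (hb : Bornology.IsBounded D) (hm : AEMeasurable q (volume.restrict D))
    (h : ∀ v : R3 → ℂ, MemLp v 2 (volume.restrict D) →
      eLpNorm (fun x => (Real.sqrt (q x) : ℂ) * v x) 2 (volume.restrict D) = 0 →
      v =ᵐ[volume.restrict D] 0) :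
    volume.restrict D ≪ weightedMeasure D q := by
  have := isFiniteMeasure_restrict_of_isBounded hb
  refine withDensity_absolutelyContinuous' hm.ennreal_ofReal ?_
  set S : Set R3 := {x | hm.mk q x ≤ 0}
  have hS : MeasurableSet S := measurableSet_le hm.measurable_mk measurable_const
  have hv : MemLp (S.indicator fun _ => (1 : ℂ)) 2 (volume.restrict D) :=
    (memLp_const 1).indicator hS
  have h0 := h _ hv ?_
  · filter_upwards [h0, hm.ae_eq_mk] with x hx hq
    have : x ∉ S := fun hxS => by simp [hxS] at hx
    have h1 : 0 < hm.mk q x := not_le.1 this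
    rw [← hq] at h1
    simpa using h1
  · have : (fun x => (Real.sqrt (q x) : ℂ) * S.indicator (fun _ => (1 : ℂ)) x)
        =ᵐ[volume.restrict D] 0 := by
      filter_upwards [hm.ae_eq_mk] with x hq
      by_cases hx : x ∈ S
      · have : q x ≤ 0 := by rw [hq]; exact hx
        simp [Real.sqrt_eq_zero_of_nonpos this]
      · simp [hx]
    rw [eLpNorm_congr_ae this, eLpNorm_zero]

namespace IsWeight

variable {D : Set R3} {q : R3 → ℝ} {Q : ℝ}

theorem weightedMeasure_absolutelyContinuous :
    weightedMeasure D q ≪ volume.restrict D :=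
  withDensity_absolutelyContinuous _ _

theorem weightedMeasure_le (hw : IsWeight D q Q) :
    weightedMeasure D q ≤ ENNReal.ofReal Q • volume := by
  calc weightedMeasure D q ≤ (volume.restrict D).withDensity (fun _ => ENNReal.ofReal Q) := by
        refine withDensity_mono ?_
        filter_upwards [hw.bounds] with x hx using ENNReal.ofReal_le_ofReal hx.2
    _ = ENNReal.ofReal Q • volume.restrict D := withDensity_const _
    _ ≤ _ := by gcongr; exact Measure.restrict_le_self

theorem memLp_weightedMeasure (hw : IsWeight D q Q) {f : R3 → ℂ} (hf : MemLp f 2 volume) :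
    MemLp f 2 (weightedMeasure D q) :=
  hf.of_measure_le_smul ENNReal.ofReal_ne_top hw.weightedMeasure_le

theorem aestronglyMeasurable_restrict (hw : IsWeight D q Q) {u : R3 → ℂ}
    (hu : MemLp u 2 (weightedMeasure D q)) : AEStronglyMeasurable u (volume.restrict D) :=
  hu.1.mono_ac hw.absolutelyContinuous

theorem aestronglyMeasurable_qmul (hw : IsWeight D q Q) {u : R3 → ℂ}
    (hu : MemLp u 2 (weightedMeasure D q)) :
    AEStronglyMeasurable (qmul q u) (volume.restrict D) :=
  (Complex.continuous_ofReal.comp_aestronglyMeasurable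
    hw.aemeasurable.aestronglyMeasurable).mul (hw.aestronglyMeasurable_restrict hu)

/-- Pointwise q² |u|² ≤ Q · q |u|²: one factor q is bounded by Q, the other is the density of the
weighted measure. -/
theorem eLpNorm_qmul_le (hw : IsWeight D q Q) {u : R3 → ℂ}
    (hu : MemLp u 2 (weightedMeasure D q)) :
    eLpNorm (D.indicator (qmul q u)) 2 volume
      ≤ ENNReal.ofReal (Real.sqrt Q) * eLpNorm u 2 (weightedMeasure D q) := by
  rw [eLpNorm_indicator_eq_eLpNorm_restrict hw.isOpen.measurableSet]
  refine (ENNReal.pow_le_pow_left_iff two_ne_zero).1 ?_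
  have e : ∀ (f : R3 → ℂ) (μ : Measure R3), eLpNorm f 2 μ ^ 2 = ∫⁻ x, ‖f x‖ₑ ^ 2 ∂μ := by
    intro f μ
    have := eLpNorm_nnreal_pow_eq_lintegral (μ := μ) (f := f) (p := 2) two_ne_zero
    simpa using this
  rw [mul_pow, e, e, ← ENNReal.ofReal_pow (Real.sqrt_nonneg _), Real.sq_sqrt hw.nonneg,
    weightedMeasure, lintegral_withDensity_eq_lintegral_mul₀ hw.aemeasurable.ennreal_ofReal
      ((hw.aestronglyMeasurable_restrict hu).enorm.pow_const 2),
    ← lintegral_const_mul' _ _ ENNReal.ofReal_ne_top]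
  refine lintegral_mono_ae ?_
  filter_upwards [hw.bounds] with x hx
  have : ‖qmul q u x‖ₑ = ENNReal.ofReal (q x) * ‖u x‖ₑ := by
    rw [qmul, enorm_mul]
    congr 1
    rw [← ofReal_norm, Complex.norm_real, Real.norm_of_nonneg hx.1]
  rw [this, Pi.mul_apply, mul_pow, pow_two (ENNReal.ofReal (q x)), mul_assoc]
  gcongr
  exact hx.2

theorem memLp_qmul (hw : IsWeight D q Q) {u : R3 → ℂ}
    (hu : MemLp u 2 (weightedMeasure D q)) : MemLp (D.indicator (qmul q u)) 2 volume := by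
  refine ⟨?_, ?_⟩
  · exact (aestronglyMeasurable_indicator_iff hw.isOpen.measurableSet).2
      (hw.aestronglyMeasurable_qmul hu)
  · exact (hw.eLpNorm_qmul_le hu).trans_lt (ENNReal.mul_lt_top ENNReal.ofReal_lt_top hu.2)

theorem integrable_qmul (hw : IsWeight D q Q) {u : R3 → ℂ}
    (hu : MemLp u 2 (weightedMeasure D q)) : Integrable (D.indicator (qmul q u)) := by
  have := isFiniteMeasure_restrict_of_isBounded hw.isBounded
  rw [integrable_indicator_iff hw.isOpen.measurableSet]
  exact ((memLp_indicator_iff_restrict hw.isOpen.measurableSet).1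
    (hw.memLp_qmul hu)).integrable one_le_two

/-- The operator `u ↦ 1_D q u` from `L²_q(D)` to `L²(ℝ³)`. -/
noncomputable def densityL2 (hw : IsWeight D q Q) : L2q D q →L[ℂ] L2R3 :=
  LinearMap.mkContinuous
    { toFun := fun u => (hw.memLp_qmul (Lp.memLp u)).toLp
      map_add' := fun u v => by
        rw [← MemLp.toLp_add]
        refine MemLp.toLp_congr _ _ ?_
        have h := (ae_restrict_iff' hw.isOpen.measurableSet).1
          (hw.absolutelyContinuous.ae_eq (Lp.coeFn_add u v))
        filter_upwards [h] with x hx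
        by_cases hD : x ∈ D
        · have : (u + v : L2q D q) x = u x + v x := hx hD
          simp only [Set.indicator_of_mem hD, qmul, this, mul_add, Pi.add_apply]
        · simp [hD]
      map_smul' := fun c u => by
        rw [RingHom.id_apply, ← MemLp.toLp_const_smul]
        refine MemLp.toLp_congr _ _ ?_
        have h := (ae_restrict_iff' hw.isOpen.measurableSet).1
          (hw.absolutelyContinuous.ae_eq (Lp.coeFn_smul c u))
        filter_upwards [h] with x hx
        by_cases hD : x ∈ D
        · have : (c • u : L2q D q) x = c • u x := hx hD
          simp [hD, qmul, this, mul_left_comm]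
        · simp [hD] }
    (Real.sqrt Q) fun u => by
      change ‖(hw.memLp_qmul (Lp.memLp u)).toLp‖ ≤ _
      rw [Lp.norm_toLp, Lp.norm_def, ← ENNReal.toReal_ofReal (Real.sqrt_nonneg Q),
        ← ENNReal.toReal_mul]
      refine ENNReal.toReal_mono ?_ (hw.eLpNorm_qmul_le (Lp.memLp u))
      exact ENNReal.mul_ne_top ENNReal.ofReal_ne_top (Lp.memLp u).2.ne

theorem coeFn_densityL2 (hw : IsWeight D q Q) (u : L2q D q) :
    D.indicator (qmul q u) =ᵐ[volume] hw.densityL2 u :=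
  (hw.memLp_qmul (Lp.memLp u)).coeFn_toLp.symm

theorem norm_densityL2_le (hw : IsWeight D q Q) : ‖hw.densityL2‖ ≤ Real.sqrt Q :=
  LinearMap.mkContinuous_norm_le _ (Real.sqrt_nonneg Q) _

/-- The adjoint of multiplication by the weight is the restriction to `D`. -/
theorem coeFn_adjoint_densityL2 (hw : IsWeight D q Q) (W : L2R3) :
    ContinuousLinearMap.adjoint hw.densityL2 W =ᵐ[weightedMeasure D q] W := by
  have hW := hw.memLp_weightedMeasure (Lp.memLp W)
  have key : ContinuousLinearMap.adjoint hw.densityL2 W = hW.toLp := by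
    refine ext_inner_right ℂ fun u => ?_
    -- Both pairings equal ∫_D q ⟨W, u⟩: in L²(ℝ³) the factor q comes from the function, in L²_q(D)
    -- from the measure.
    rw [ContinuousLinearMap.adjoint_inner_left, L2.inner_def, L2.inner_def]
    have h1 : ∫ x, inner ℂ ((hW.toLp : L2q D q) x) (u x) ∂(weightedMeasure D q)
        = ∫ x, inner ℂ (W x) (u x) ∂(weightedMeasure D q) := by
      refine integral_congr_ae ?_
      filter_upwards [hW.coeFn_toLp] with x hx
      rw [hx]
    have h2 : ∫ x, inner ℂ (W x) (hw.densityL2 u x)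
        = ∫ x, D.indicator (fun x => inner ℂ (W x) (qmul q u x)) x := by
      refine integral_congr_ae ?_
      filter_upwards [hw.coeFn_densityL2 u] with x hx
      rw [← hx]
      by_cases hD : x ∈ D <;> simp [hD]
    have h3 : ∫ x, inner ℂ (W x) (u x) ∂(weightedMeasure D q)
        = ∫ x in D, (ENNReal.ofReal (q x)).toReal • inner ℂ (W x) (u x) :=
      integral_withDensity_eq_integral_toReal_smul₀ hw.aemeasurable.ennreal_ofReal
        (Filter.Eventually.of_forall fun _ => ENNReal.ofReal_lt_top) _
    rw [h1, h2, h3, integral_indicator hw.isOpen.measurableSet]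
    refine integral_congr_ae ?_
    filter_upwards [hw.bounds] with x hx
    rw [ENNReal.toReal_ofReal hx.1, qmul, ← smul_eq_mul, inner_smul_right, Complex.real_smul]
  rw [key]
  exact hW.coeFn_toLp

theorem fundSol_eq_kern (c₀ : ℝ) (s : ℂ) (x y : R3) :
    fundSol c₀ s x y = kern (s / c₀) (x - y) := by
  unfold fundSol kern
  congr 2
  ring

theorem re_div_pos {c₀ : ℝ} (hc : 0 < c₀) {s : ℂ} (hs : 0 < s.re) : 0 < (s / (c₀ : ℂ)).re := by
  rw [Complex.div_ofReal_re]
  positivity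

/-- The volume potential is the resolvent applied to the density. -/
theorem volPot_ae_eq (hw : IsWeight D q Q) {c₀ : ℝ} {s : ℂ} (hκ : 0 < (s / (c₀ : ℂ)).re)
    (u : L2q D q) :
    volPot c₀ s D (qmul q u) =ᵐ[volume] resolvent (s / (c₀ : ℂ)) hκ (hw.densityL2 u) := by
  have h := convolution_kern_ae_eq hκ (hw.integrable_qmul (Lp.memLp u)) (hw.coeFn_densityL2 u)
  refine Filter.EventuallyEq.trans (Filter.EventuallyEq.of_eq ?_) h
  ext x
  rw [volPot, ← integral_indicator hw.isOpen.measurableSet]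
  congr with y
  by_cases hD : y ∈ D <;> simp [hD, fundSol_eq_kern]

/-! ### Coercivity and solvability of the integral equation -/

/-- The operator `u ↦ κ² V (q u)` on `L²_q(D)`. -/
noncomputable def potentialL2 (hw : IsWeight D q Q) (κ : ℂ) (hκ : 0 < κ.re) :
    L2q D q →L[ℂ] L2q D q :=
  κ ^ 2 • (ContinuousLinearMap.adjoint hw.densityL2 ∘L resolvent κ hκ ∘L hw.densityL2)

theorem coeFn_potentialL2 (hw : IsWeight D q Q) {c₀ : ℝ} {s : ℂ}
    (hκ : 0 < (s / (c₀ : ℂ)).re) (u : L2q D q) :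
    hw.potentialL2 (s / (c₀ : ℂ)) hκ u =ᵐ[weightedMeasure D q]
      fun x => s ^ 2 / (c₀ : ℂ) ^ 2 * volPot c₀ s D (qmul q u) x := by
  have hac : weightedMeasure D q ≪ volume :=
    weightedMeasure_absolutelyContinuous.trans Measure.restrict_le_self.absolutelyContinuous
  have h1 := hac.ae_eq (hw.volPot_ae_eq hκ u)
  have h2 := hw.coeFn_adjoint_densityL2 (resolvent (s / (c₀ : ℂ)) hκ (hw.densityL2 u))
  have h3 := Lp.coeFn_smul ((s / (c₀ : ℂ)) ^ 2)
    (ContinuousLinearMap.adjoint hw.densityL2 (resolvent (s / (c₀ : ℂ)) hκ (hw.densityL2 u)))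
  filter_upwards [h1, h2, h3] with x h1 h2 h3
  rw [h1, ← h2, ← div_pow]
  exact h3

theorem isSolution_iff (hw : IsWeight D q Q) {c₀ : ℝ} {s : ℂ} (hκ : 0 < (s / (c₀ : ℂ)).re)
    (uinc u : L2q D q) :
    IsSolution c₀ s D q uinc u ↔
      (1 + hw.potentialL2 (s / (c₀ : ℂ)) hκ) u = hw.potentialL2 (s / (c₀ : ℂ)) hκ uinc := by
  rw [Lp.ext_iff, IsSolution]
  have h1 := hw.coeFn_potentialL2 hκ u
  have h2 := hw.coeFn_potentialL2 hκ uinc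
  have h3 := Lp.coeFn_add u (hw.potentialL2 (s / (c₀ : ℂ)) hκ u)
  refine Filter.eventually_congr ?_
  filter_upwards [h1, h2, h3] with x h1 h2 h3
  rw [← h1, ← h2]
  change _ ↔ (u + hw.potentialL2 (s / (c₀ : ℂ)) hκ u : L2q D q) x = _
  rw [h3]
  rfl

theorem norm_potentialL2_le (hw : IsWeight D q Q) {κ : ℂ} (hκ : 0 < κ.re) (u : L2q D q) :
    ‖hw.potentialL2 κ hκ u‖ ≤ Q * ‖κ‖ / κ.re * ‖u‖ := by
  have h1 := norm_pos_of_re_pos hκ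
  have hM := hw.norm_densityL2_le
  have hA : ‖ContinuousLinearMap.adjoint hw.densityL2‖ ≤ ‖hw.densityL2‖ :=
    (LinearIsometryEquiv.norm_map _ _).le
  calc ‖hw.potentialL2 κ hκ u‖
      = ‖κ‖ ^ 2 * ‖ContinuousLinearMap.adjoint hw.densityL2
          (resolvent κ hκ (hw.densityL2 u))‖ := by
        rw [← norm_pow, ← norm_smul]
        rfl
    _ ≤ ‖κ‖ ^ 2 * (Real.sqrt Q * (1 / (κ.re * ‖κ‖) * (Real.sqrt Q * ‖u‖))) := by
        gcongr
        refine (ContinuousLinearMap.le_of_opNorm_le _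
          (hA.trans hM) _).trans ?_
        gcongr
        refine (norm_resolvent_apply_le hκ _).trans ?_
        gcongr
        exact ContinuousLinearMap.le_of_opNorm_le _ hM u
    _ = (Real.sqrt Q * Real.sqrt Q) * ‖κ‖ / κ.re * ‖u‖ := by field_simp
    _ = _ := by rw [Real.mul_self_sqrt hw.nonneg]

theorem re_mul_inner_potentialL2_nonneg (hw : IsWeight D q Q) {κ : ℂ} (hκ : 0 < κ.re)
    (u : L2q D q) : 0 ≤ ((starRingEnd ℂ) κ * inner ℂ u (hw.potentialL2 κ hκ u)).re := by
  have h := re_mul_inner_resolvent_nonneg hκ (hw.densityL2 u)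
  have : inner ℂ u (hw.potentialL2 κ hκ u)
      = κ ^ 2 * inner ℂ (hw.densityL2 u) (resolvent κ hκ (hw.densityL2 u)) := by
    rw [← ContinuousLinearMap.adjoint_inner_right, ← inner_smul_right]
    rfl
  rwa [this, ← mul_assoc]

/-- Pairing with u and multiplying by κ̄, the identity contributes Re κ ‖u‖² and the potential a
nonnegative term. -/
theorem re_mul_norm_sq_le (hw : IsWeight D q Q) {κ : ℂ} (hκ : 0 < κ.re) (u : L2q D q) :
    κ.re * ‖u‖ ^ 2 ≤ ‖κ‖ * ‖inner ℂ u ((1 + hw.potentialL2 κ hκ) u)‖ := by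
  have h := hw.re_mul_inner_potentialL2_nonneg hκ u
  have e : ((starRingEnd ℂ) κ * inner ℂ u ((1 + hw.potentialL2 κ hκ) u)).re
      = κ.re * ‖u‖ ^ 2 + ((starRingEnd ℂ) κ * inner ℂ u (hw.potentialL2 κ hκ u)).re := by
    rw [add_apply, one_apply_eq_self, inner_add_right, mul_add,
      Complex.add_re, inner_self_eq_norm_sq_to_K]
    congr 1
    have : (((‖u‖ : ℝ) : ℂ)) ^ 2 = ((‖u‖ ^ 2 : ℝ) : ℂ) := by push_cast; rfl
    change ((starRingEnd ℂ) κ * ((‖u‖ : ℝ) : ℂ) ^ 2).re = _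
    rw [this, Complex.re_mul_ofReal, Complex.conj_re]
  calc κ.re * ‖u‖ ^ 2 ≤ ((starRingEnd ℂ) κ * inner ℂ u ((1 + hw.potentialL2 κ hκ) u)).re := by
        rw [e]; linarith
    _ ≤ ‖(starRingEnd ℂ) κ * inner ℂ u ((1 + hw.potentialL2 κ hκ) u)‖ := Complex.re_le_norm _
    _ = _ := by rw [norm_mul, RCLike.norm_conj]

/-- This is the Lax–Milgram argument with coercivity constant Re κ / |κ|; no compactness is needed.
-/
theorem isUnit_one_add_potentialL2 (hw : IsWeight D q Q) {κ : ℂ} (hκ : 0 < κ.re) :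
    IsUnit (1 + hw.potentialL2 κ hκ) := by
  have h1 := norm_pos_of_re_pos hκ
  refine ContinuousLinearMap.isUnit_of_forall_le_norm_inner_map _
    (c := ⟨κ.re / ‖κ‖, by positivity⟩) (by change 0 < κ.re / ‖κ‖; positivity) fun u => ?_
  change ‖u‖ ^ 2 * (κ.re / ‖κ‖) ≤ _
  rw [norm_inner_symm, mul_div_assoc', div_le_iff₀ h1]
  have := hw.re_mul_norm_sq_le hκ u
  linarith

theorem norm_le_norm_one_add_potentialL2 (hw : IsWeight D q Q) {κ : ℂ} (hκ : 0 < κ.re)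
    (u : L2q D q) : ‖u‖ ≤ ‖κ‖ / κ.re * ‖(1 + hw.potentialL2 κ hκ) u‖ := by
  have h1 := norm_pos_of_re_pos hκ
  rcases (norm_nonneg u).eq_or_lt with h0 | h0
  · rw [← h0]; positivity
  · have h2 := hw.re_mul_norm_sq_le hκ u
    have h3 := norm_inner_le_norm (𝕜 := ℂ) u ((1 + hw.potentialL2 κ hκ) u)
    rw [div_mul_eq_mul_div, le_div_iff₀ hκ]
    refine le_of_mul_le_mul_right ?_ h0
    calc ‖u‖ * κ.re * ‖u‖ = κ.re * ‖u‖ ^ 2 := by ring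
      _ ≤ ‖κ‖ * (‖u‖ * ‖(1 + hw.potentialL2 κ hκ) u‖) := h2.trans (by gcongr)
      _ = _ := by ring

theorem existsUnique_isSolution (hw : IsWeight D q Q) {c₀ : ℝ} (hc : 0 < c₀) {s : ℂ}
    (hs : 0 < s.re) (uinc : L2q D q) : ∃! u : L2q D q, IsSolution c₀ s D q uinc u := by
  have hκ := re_div_pos hc hs
  simp only [hw.isSolution_iff hκ]
  have := hw.isUnit_one_add_potentialL2 hκ
  rw [ContinuousLinearMap.isUnit_iff_bijective] at this
  exact this.existsUnique _

theorem norm_le_of_isSolution (hw : IsWeight D q Q) {c₀ : ℝ} (hc : 0 < c₀) {s : ℂ}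
    (hs : 0 < s.re) {uinc u : L2q D q} (h : IsSolution c₀ s D q uinc u) :
    ‖u‖ ≤ Q / s.re ^ 2 * ‖s‖ ^ 2 * ‖uinc‖ := by
  have hκ := re_div_pos hc hs
  rw [hw.isSolution_iff hκ] at h
  have h1 := hw.norm_le_norm_one_add_potentialL2 hκ u
  rw [h] at h1
  have h2 := hw.norm_potentialL2_le hκ uinc
  -- One ratio |κ| / Re κ comes from inverting 1 + T, the other from bounding T. Both equal |s| / Re
  -- s, so c₀ cancels.
  calc ‖u‖ ≤ ‖s / (c₀ : ℂ)‖ / (s / (c₀ : ℂ)).re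
        * (Q * ‖s / (c₀ : ℂ)‖ / (s / (c₀ : ℂ)).re * ‖uinc‖) := h1.trans (by gcongr)
    _ = _ := by
      rw [norm_div, Complex.div_ofReal_re, Complex.norm_real, Real.norm_of_nonneg hc.le]
      field_simp

/-- By linearity the extension is the resolvent of a single L² density, the form from which all
regularity is read off. -/
theorem solExt_ae_eq (hw : IsWeight D q Q) {c₀ : ℝ} {s : ℂ} (hκ : 0 < (s / (c₀ : ℂ)).re)
    (uinc u : L2q D q) :
    solExt c₀ s D q uinc u =ᵐ[volume]
      resolvent (s / (c₀ : ℂ)) hκ ((s / (c₀ : ℂ)) ^ 2 • hw.densityL2 (uinc - u)) := by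
  rw [map_smul, map_sub, map_sub]
  filter_upwards [hw.volPot_ae_eq hκ u, hw.volPot_ae_eq hκ uinc,
    Lp.coeFn_smul ((s / (c₀ : ℂ)) ^ 2) (resolvent (s / (c₀ : ℂ)) hκ (hw.densityL2 uinc)
      - resolvent (s / (c₀ : ℂ)) hκ (hw.densityL2 u)),
    Lp.coeFn_sub (resolvent (s / (c₀ : ℂ)) hκ (hw.densityL2 uinc))
      (resolvent (s / (c₀ : ℂ)) hκ (hw.densityL2 u))] with x h1 h2 h3 h4
  rw [h3, Pi.smul_apply, h4, Pi.sub_apply, ← h1, ← h2, solExt, div_pow, smul_eq_mul, mul_sub]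

/-- The equation is only known almost everywhere for the weighted measure; absolute continuity
upgrades this to Lebesgue measure on D. -/
theorem solExt_ae_eq_self (hw : IsWeight D q Q) {c₀ : ℝ} {s : ℂ} {uinc u : L2q D q}
    (h : IsSolution c₀ s D q uinc u) :
    solExt c₀ s D q uinc u =ᵐ[volume.restrict D] u := by
  have h1 := hw.absolutelyContinuous.ae_le h
  filter_upwards [h1] with x hx
  rw [solExt, ← hx, add_sub_cancel_right]

end IsWeight

/-! ### Weak derivatives on subsets and Sobolev bounds for the resolvent -/

theorem locallyIntegrableOn_congr_ae {Ω : Set R3} {f g : R3 → ℂ}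
    (hf : LocallyIntegrableOn f Ω volume) (h : f =ᵐ[volume.restrict Ω] g) :
    LocallyIntegrableOn g Ω volume := by
  intro x hx
  obtain ⟨t, ht, hft⟩ := hf x hx
  refine ⟨t ∩ Ω, Filter.inter_mem ht self_mem_nhdsWithin, ?_⟩
  exact (hft.mono_set Set.inter_subset_left).congr_fun_ae
    (ae_restrict_of_ae_restrict_of_subset Set.inter_subset_right h)

namespace IsWeakPartial

theorem congr_ae {Ω : Set R3} {i : Fin 3} {u u' g g' : R3 → ℂ} (h : IsWeakPartial Ω i u g)
    (hu : u =ᵐ[volume.restrict Ω] u') (hg : g =ᵐ[volume.restrict Ω] g') :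
    IsWeakPartial Ω i u' g' := by
  refine ⟨locallyIntegrableOn_congr_ae h.1 hu, locallyIntegrableOn_congr_ae h.2.1 hg, ?_⟩
  intro φ hφ hc hs
  have e1 : ∫ x in Ω, (fderiv ℝ φ x (EuclideanSpace.single i (1 : ℝ))) • u' x
      = ∫ x in Ω, (fderiv ℝ φ x (EuclideanSpace.single i (1 : ℝ))) • u x :=
    integral_congr_ae (by filter_upwards [hu] with x hx; rw [hx])
  have e2 : ∫ x in Ω, φ x • g' x = ∫ x in Ω, φ x • g x :=
    integral_congr_ae (by filter_upwards [hg] with x hx; rw [hx])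
  rw [e1, e2]
  exact h.2.2 φ hφ hc hs

theorem restrict {Ω : Set R3} {i : Fin 3} {u g : R3 → ℂ} (h : IsWeakPartial Set.univ i u g) :
    IsWeakPartial Ω i u g := by
  refine ⟨h.1.mono_set (Set.subset_univ _), h.2.1.mono_set (Set.subset_univ _), ?_⟩
  intro φ hφ hc hs
  have key := h.2.2 φ hφ hc (Set.subset_univ _)
  rw [Measure.restrict_univ] at key
  rw [setIntegral_eq_integral_of_forall_compl_eq_zero,
    setIntegral_eq_integral_of_forall_compl_eq_zero, key]
  · intro x hx
    have h0 : φ x = 0 := image_eq_zero_of_notMem_tsupport (fun hx' => hx (hs hx'))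
    rw [h0, zero_smul]
  · intro x hx
    have h0 : fderiv ℝ φ x = 0 := fderiv_of_notMem_tsupport ℝ (fun hx' => hx (hs hx'))
    rw [h0, zero_apply, zero_smul]

theorem weakPartial_ae_eq {Ω : Set R3} (hΩ : IsOpen Ω) {i : Fin 3} {u g : R3 → ℂ}
    (h : IsWeakPartial Ω i u g) : weakPartial Ω i u =ᵐ[volume.restrict Ω] g := by
  have hex : ∃ g, IsWeakPartial Ω i u g := ⟨g, h⟩
  rw [weakPartial, dif_pos hex]
  exact IsWeakPartial.ae_eq hΩ hex.choose_spec h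

end IsWeakPartial

theorem l2Sq_congr_ae {Ω : Set R3} {u v : R3 → ℂ} (h : u =ᵐ[volume.restrict Ω] v) :
    l2Sq Ω u = l2Sq Ω v :=
  integral_congr_ae (by filter_upwards [h] with x hx; rw [hx])

theorem l2Sq_le_norm_sq (Ω : Set R3) (f : L2R3) : l2Sq Ω f ≤ ‖f‖ ^ 2 := by
  rw [← l2Sq_univ_eq_norm_sq, l2Sq, l2Sq, Measure.restrict_univ]
  exact setIntegral_le_integral (integrable_norm_sq f)
    (Filter.Eventually.of_forall fun x => sq_nonneg _)

theorem memH1_of_ae_eq {Ω : Set R3} {u : R3 → ℂ} {W : L2R3} {V : Fin 3 → L2R3}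
    (hu : u =ᵐ[volume.restrict Ω] W) (hV : ∀ i, IsWeakPartial Set.univ i W (V i)) :
    MemH1 Ω u :=
  ⟨((Lp.memLp W).restrict Ω).ae_eq hu.symm, fun i =>
    ⟨V i, (hV i).restrict.congr_ae hu.symm Filter.EventuallyEq.rfl, (Lp.memLp (V i)).restrict Ω⟩⟩

theorem weakPartial_ae_eq_of_ae_eq {Ω : Set R3} (hΩ : IsOpen Ω) {u : R3 → ℂ} {W V : L2R3}
    {i : Fin 3} (hu : u =ᵐ[volume.restrict Ω] W) (hV : IsWeakPartial Set.univ i W V) :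
    weakPartial Ω i u =ᵐ[volume.restrict Ω] V :=
  (hV.restrict.congr_ae hu.symm Filter.EventuallyEq.rfl).weakPartial_ae_eq hΩ

/-- The symbol of the `i`-th partial derivative. -/
noncomputable def derivSymbol (i : Fin 3) (ξ : R3) : ℂ := 2 * Real.pi * Complex.I * (ξ i : ℝ)

theorem continuous_derivSymbol (i : Fin 3) : Continuous (derivSymbol i) := by
  unfold derivSymbol; fun_prop

theorem norm_derivSymbol (i : Fin 3) (ξ : R3) : ‖derivSymbol i ξ‖ = 2 * Real.pi * |ξ i| := by
  simp [derivSymbol, abs_of_pos Real.pi_pos]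

theorem sum_norm_sq_derivSymbol (ξ : R3) : ∑ i, ‖derivSymbol i ξ‖ ^ 2 = lapSymbol ξ := by
  simp only [norm_derivSymbol, mul_pow, sq_abs, ← Finset.mul_sum, lapSymbol,
    EuclideanSpace.real_norm_sq_eq]
  ring

theorem norm_sq_derivSymbol_le (i : Fin 3) (ξ : R3) : ‖derivSymbol i ξ‖ ^ 2 ≤ lapSymbol ξ := by
  rw [← sum_norm_sq_derivSymbol]
  exact Finset.single_le_sum (f := fun i => ‖derivSymbol i ξ‖ ^ 2)
    (fun i _ => sq_nonneg _) (Finset.mem_univ i)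

theorem norm_derivSymbol_le (i : Fin 3) (ξ : R3) : ‖derivSymbol i ξ‖ ≤ 1 + lapSymbol ξ := by
  have := norm_sq_derivSymbol_le i ξ
  nlinarith [sq_nonneg (‖derivSymbol i ξ‖ - 1), norm_nonneg (derivSymbol i ξ)]

theorem norm_derivSymbol_mul_le (j i : Fin 3) (ξ : R3) :
    ‖derivSymbol j ξ * derivSymbol i ξ‖ ≤ 1 + lapSymbol ξ := by
  rw [norm_mul]
  have h1 := norm_sq_derivSymbol_le i ξ
  have h2 := norm_sq_derivSymbol_le j ξ
  nlinarith [sq_nonneg (‖derivSymbol j ξ‖ - ‖derivSymbol i ξ‖)]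

/-- The first derivatives of the resolvent. -/
noncomputable def derivResolvent (κ : ℂ) (hκ : 0 < κ.re) (i : Fin 3) : L2R3 →L[ℂ] L2R3 :=
  fourierMul (resolventMul κ hκ (derivSymbol i) (continuous_derivSymbol i)
    (norm_derivSymbol_le i))

/-- The second derivatives of the resolvent. -/
noncomputable def derivDerivResolvent (κ : ℂ) (hκ : 0 < κ.re) (j i : Fin 3) :
    L2R3 →L[ℂ] L2R3 :=
  fourierMul (resolventMul κ hκ (fun ξ => derivSymbol j ξ * derivSymbol i ξ)
    ((continuous_derivSymbol j).mul (continuous_derivSymbol i)) (norm_derivSymbol_mul_le j i))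

section Derivatives

variable {κ : ℂ} (hκ : 0 < κ.re)

theorem isWeakPartial_resolvent (i : Fin 3) (f : L2R3) :
    IsWeakPartial Set.univ i (resolvent κ hκ f) (derivResolvent κ hκ i f) :=
  isWeakPartial_fourierMul (fun ξ => by
    rw [resolventMul_apply, resolventMul_apply, one_mul, derivSymbol]) f

theorem isWeakPartial_derivResolvent (j i : Fin 3) (f : L2R3) :
    IsWeakPartial Set.univ j (derivResolvent κ hκ i f) (derivDerivResolvent κ hκ j i f) :=
  isWeakPartial_fourierMul (fun ξ => by
    rw [resolventMul_apply, resolventMul_apply, ← mul_assoc]; rfl) f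

theorem norm_fourierMul_resolventMul_le {p : R3 → ℂ} (hp : Continuous p)
    (hb : ∀ ξ, ‖p ξ‖ ≤ 1 + lapSymbol ξ) (f : L2R3) :
    ‖fourierMul (resolventMul κ hκ p hp hb) f‖ ^ 2
      ≤ (‖κ‖ / κ.re * (1 + 1 / ‖κ‖ ^ 2) * ‖f‖) ^ 2 := by
  gcongr
  exact norm_fourierMul_le (norm_resolventMul_le hκ hp hb) f

/-- The energy estimate for the resolvent. -/
theorem sum_norm_sq_derivResolvent_add_le {c : ℝ} (hc : 0 ≤ c) (f : L2R3) :
    (∑ i, ‖derivResolvent κ hκ i f‖ ^ 2) + (c * ‖κ‖) ^ 2 * ‖resolvent κ hκ f‖ ^ 2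
      ≤ (max 1 c / κ.re * ‖f‖) ^ 2 := by
  set m₀ := resolventMul κ hκ (fun _ => 1) continuous_const
    (fun ξ => by simpa using lapSymbol_nonneg ξ) with hm₀
  set m₁ := fun i => resolventMul κ hκ (derivSymbol i) (continuous_derivSymbol i)
    (norm_derivSymbol_le i) with hm₁
  -- The index `none` carries the zero-order term with weight (c |κ|)², the others the three
  -- derivatives with weight 1.
  have h := sum_mul_norm_sq_mulL2_le (ι := Option (Fin 3))
    (c := fun o => o.elim ((c * ‖κ‖) ^ 2) fun _ => 1) (m := fun o => o.elim m₀ m₁)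
    (K := (max 1 c / κ.re) ^ 2) (fun ξ => ?_) (𝓕 f)
  · simp only [Fintype.sum_option, Option.elim, one_mul, Lp.norm_fourier_eq,
      ← norm_fourierMul] at h
    rw [mul_pow (max 1 c / κ.re), add_comm]
    exact h
  · have h0 := lapSymbol_nonneg ξ
    have h1 := norm_pos_of_re_pos hκ
    have h2 := re_mul_le_norm_mul (κ := κ) (lapSymbol ξ)
    have h3 := norm_resolvent_pos h0 hκ
    simp only [Fintype.sum_option, Option.elim, one_mul, hm₀, hm₁, resolventMul_apply, norm_mul,
      mul_pow, norm_div, norm_one, div_pow, one_pow, ← Finset.sum_mul, sum_norm_sq_derivSymbol]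
    set N := ‖(lapSymbol ξ : ℂ) + κ ^ 2‖
    set r := lapSymbol ξ
    set B := max 1 c with hB
    have hB1 : 1 ≤ B := le_max_left _ _
    have hBc : c ≤ B := le_max_right _ _
    have e1 : c ^ 2 * ‖κ‖ ^ 2 + r ≤ B ^ 2 * (r + ‖κ‖ ^ 2) := by
      have : c ^ 2 * ‖κ‖ ^ 2 ≤ B ^ 2 * ‖κ‖ ^ 2 := by gcongr
      have : 1 * r ≤ B ^ 2 * r := by gcongr; exact one_le_pow₀ hB1
      linarith
    -- Square the coercivity estimate, then cancel one factor r + |κ|² using |κ|² ≤ r + |κ|².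
    have e2 : (r + ‖κ‖ ^ 2) * κ.re ^ 2 ≤ N ^ 2 := by
      have h4 : (κ.re * (r + ‖κ‖ ^ 2)) ^ 2 ≤ (‖κ‖ * N) ^ 2 := by gcongr
      have h5 : 0 < r + ‖κ‖ ^ 2 := by positivity
      have h6 : ‖κ‖ ^ 2 * ((r + ‖κ‖ ^ 2) * κ.re ^ 2) ≤ ‖κ‖ ^ 2 * N ^ 2 := by
        calc ‖κ‖ ^ 2 * ((r + ‖κ‖ ^ 2) * κ.re ^ 2)
            ≤ (r + ‖κ‖ ^ 2) * ((r + ‖κ‖ ^ 2) * κ.re ^ 2) := by gcongr; linarith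
          _ = (κ.re * (r + ‖κ‖ ^ 2)) ^ 2 := by ring
          _ ≤ _ := h4
          _ = _ := by ring
      exact le_of_mul_le_mul_left h6 (by positivity)
    rw [le_div_iff₀ (by positivity)]
    calc (c ^ 2 * ‖κ‖ ^ 2 * (1 / N ^ 2) + r * (1 / N ^ 2)) * κ.re ^ 2
        = (c ^ 2 * ‖κ‖ ^ 2 + r) * κ.re ^ 2 / N ^ 2 := by ring
      _ ≤ (B ^ 2 * (r + ‖κ‖ ^ 2)) * κ.re ^ 2 / N ^ 2 := by gcongr
      _ = B ^ 2 * ((r + ‖κ‖ ^ 2) * κ.re ^ 2) / N ^ 2 := by ring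
      _ ≤ B ^ 2 * N ^ 2 / N ^ 2 := by gcongr
      _ = B ^ 2 := by field_simp

end Derivatives

/-- Functions that agree on `Ω` with the resolvent of a square integrable function. -/
theorem memH2_of_ae_eq_resolvent {Ω : Set R3} (hΩ : IsOpen Ω) {κ : ℂ} (hκ : 0 < κ.re)
    {u : R3 → ℂ} {f : L2R3} (hu : u =ᵐ[volume.restrict Ω] resolvent κ hκ f) : MemH2 Ω u :=
  ⟨memH1_of_ae_eq hu fun i => isWeakPartial_resolvent hκ i f, fun i =>
    memH1_of_ae_eq (weakPartial_ae_eq_of_ae_eq hΩ hu (isWeakPartial_resolvent hκ i f))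
      fun j => isWeakPartial_derivResolvent hκ j i f⟩

/-- There are 1 + 3 + 9 = 13 terms, each at most K², and 13 ≤ 4². -/
theorem h2Norm_le_of_ae_eq_resolvent {Ω : Set R3} (hΩ : IsOpen Ω) {κ : ℂ} (hκ : 0 < κ.re)
    {u : R3 → ℂ} {f : L2R3} (hu : u =ᵐ[volume.restrict Ω] resolvent κ hκ f) :
    h2Norm Ω u ≤ 4 * (‖κ‖ / κ.re * (1 + 1 / ‖κ‖ ^ 2) * ‖f‖) := by
  set K := ‖κ‖ / κ.re * (1 + 1 / ‖κ‖ ^ 2) * ‖f‖ with hK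
  have hK0 : 0 ≤ K := by positivity
  have h1 : ∀ i, weakPartial Ω i u =ᵐ[volume.restrict Ω] derivResolvent κ hκ i f := fun i =>
    weakPartial_ae_eq_of_ae_eq hΩ hu (isWeakPartial_resolvent hκ i f)
  have h2 : ∀ i j, weakPartial Ω j (weakPartial Ω i u)
      =ᵐ[volume.restrict Ω] derivDerivResolvent κ hκ j i f := fun i j =>
    weakPartial_ae_eq_of_ae_eq hΩ (h1 i) (isWeakPartial_derivResolvent hκ j i f)
  have b0 : l2Sq Ω u ≤ K ^ 2 := by
    rw [l2Sq_congr_ae hu]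
    exact (l2Sq_le_norm_sq Ω _).trans (norm_fourierMul_resolventMul_le hκ _ _ f)
  have b1 : ∀ i, l2Sq Ω (weakPartial Ω i u) ≤ K ^ 2 := fun i => by
    rw [l2Sq_congr_ae (h1 i)]
    exact (l2Sq_le_norm_sq Ω _).trans (norm_fourierMul_resolventMul_le hκ _ _ f)
  have b2 : ∀ i j, l2Sq Ω (weakPartial Ω j (weakPartial Ω i u)) ≤ K ^ 2 := fun i j => by
    rw [l2Sq_congr_ae (h2 i j)]
    exact (l2Sq_le_norm_sq Ω _).trans (norm_fourierMul_resolventMul_le hκ _ _ f)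
  have s1 : ∑ i, l2Sq Ω (weakPartial Ω i u) ≤ 3 * K ^ 2 := by
    simpa using Finset.sum_le_sum fun i (_ : i ∈ Finset.univ) => b1 i
  have s2 : ∑ i, ∑ j, l2Sq Ω (weakPartial Ω j (weakPartial Ω i u)) ≤ 3 * (3 * K ^ 2) := by
    simpa using Finset.sum_le_sum fun i (_ : i ∈ Finset.univ) =>
      Finset.sum_le_sum fun j (_ : j ∈ Finset.univ) => b2 i j
  rw [h2Norm]
  refine Real.sqrt_le_iff.2 ⟨by positivity, ?_⟩
  nlinarith [sq_nonneg K]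

theorem h1sNorm_le_of_ae_eq_resolvent {c₀ : ℝ} (hc : 0 < c₀) {s : ℂ}
    (hκ : 0 < (s / (c₀ : ℂ)).re) {w : R3 → ℂ} {f : L2R3}
    (hw : w =ᵐ[volume] resolvent (s / (c₀ : ℂ)) hκ f) :
    h1sNorm s Set.univ w ≤ max 1 c₀ / (s / (c₀ : ℂ)).re * ‖f‖ := by
  have hw : w =ᵐ[volume.restrict Set.univ] resolvent (s / (c₀ : ℂ)) hκ f :=
    ae_restrict_of_ae hw
  have h1 := fun i => weakPartial_ae_eq_of_ae_eq isOpen_univ hw (isWeakPartial_resolvent hκ i f)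
  refine Real.sqrt_le_iff.2 ⟨by positivity, ?_⟩
  rw [l2Sq_congr_ae hw, l2Sq_univ_eq_norm_sq]
  simp only [fun i => l2Sq_congr_ae (h1 i), l2Sq_univ_eq_norm_sq]
  -- The choice c = c₀ turns the weight c |κ| into |s|.
  have h2 := sum_norm_sq_derivResolvent_add_le hκ hc.le f
  have h3 : c₀ * ‖s / (c₀ : ℂ)‖ = ‖s‖ := by
    rw [norm_div, Complex.norm_real, Real.norm_of_nonneg hc.le]
    field_simp
  rwa [h3] at h2

/-- A negative upper bound contradicts q ≥ 0 unless D is null, and then the weighted space is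
trivial. -/
theorem norm_eq_zero_of_neg {D : Set R3} {q : R3 → ℝ} {Q : ℝ}
    (h : ∀ᵐ x ∂(volume.restrict D), 0 ≤ q x ∧ q x ≤ Q) (hQ : Q < 0) (v : L2q D q) : ‖v‖ = 0 := by
  have h0 : volume.restrict D = 0 := by
    rw [← ae_eq_bot, ← Filter.eventually_false_iff_eq_bot]
    filter_upwards [h] with x hx
    linarith [hx.1, hx.2]
  have h1 : weightedMeasure D q = 0 := by
    rw [weightedMeasure, h0, withDensity_zero_left]
  have h2 : v = 0 := Lp.ext (by
    rw [Filter.EventuallyEq, ae_eq_bot.2 h1]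
    exact Filter.eventually_bot)
  rw [h2, norm_zero]

/-! ### The bounds for the solution -/

namespace IsWeight

variable {D : Set R3} {q : R3 → ℝ} {Q : ℝ}

theorem norm_smul_densityL2_le (hw : IsWeight D q Q) {c₀ : ℝ} (hc : 0 < c₀) {s : ℂ}
    (hs : 0 < s.re) {uinc u : L2q D q} (h : IsSolution c₀ s D q uinc u) :
    ‖(s / (c₀ : ℂ)) ^ 2 • hw.densityL2 (uinc - u)‖
      ≤ ‖s‖ ^ 2 / c₀ ^ 2 * (Real.sqrt Q * ((1 + Q / s.re ^ 2 * ‖s‖ ^ 2) * ‖uinc‖)) := by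
  rw [norm_smul, norm_pow, norm_div, Complex.norm_real, Real.norm_of_nonneg hc.le, div_pow]
  gcongr
  refine (ContinuousLinearMap.le_of_opNorm_le _ hw.norm_densityL2_le _).trans ?_
  gcongr
  refine (norm_sub_le _ _).trans ?_
  have := hw.norm_le_of_isSolution hc hs h
  linarith

theorem h1sNorm_solExt_le (hw : IsWeight D q Q) {c₀ : ℝ} (hc : 0 < c₀) {s : ℂ}
    (hs : 0 < s.re) {uinc u : L2q D q} (h : IsSolution c₀ s D q uinc u) :
    h1sNorm s Set.univ (solExt c₀ s D q uinc u)
      ≤ max 1 (1 / c₀) * (‖s‖ ^ 2 / s.re) * Real.sqrt Q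
        * (1 + Q / s.re ^ 2 * ‖s‖ ^ 2) * ‖uinc‖ := by
  have hκ := re_div_pos hc hs
  refine (h1sNorm_le_of_ae_eq_resolvent hc hκ (hw.solExt_ae_eq hκ uinc u)).trans ?_
  have hm : max 1 c₀ = c₀ * max 1 (1 / c₀) := by
    rw [mul_max_of_nonneg _ _ hc.le, mul_one, mul_one_div_cancel hc.ne', max_comm]
  calc max 1 c₀ / (s / (c₀ : ℂ)).re * ‖(s / (c₀ : ℂ)) ^ 2 • hw.densityL2 (uinc - u)‖
      ≤ max 1 c₀ / (s / (c₀ : ℂ)).re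
        * (‖s‖ ^ 2 / c₀ ^ 2 * (Real.sqrt Q * ((1 + Q / s.re ^ 2 * ‖s‖ ^ 2) * ‖uinc‖))) := by
        gcongr
        exact hw.norm_smul_densityL2_le hc hs h
    _ = _ := by
        rw [hm, Complex.div_ofReal_re]
        field_simp

/-- The constant in the `H²` bound. -/
noncomputable def h2Const (c₀ Q σ₀ : ℝ) : ℝ :=
  -- The final 1 keeps the constant positive when Q = 0.
  4 * (1 / σ₀ * (1 + c₀ ^ 2 / σ₀ ^ 2)) * (1 / c₀ ^ 2) * (Real.sqrt Q * ((1 + Q) / σ₀ ^ 2)) + 1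

/-- The fifth power collects |s| from |κ| / Re κ, |s|² from the factor κ², and |s|² from the bound
on uinc - u. Lower powers are absorbed using |s| ≥ σ₀. -/
theorem h2Norm_le (hw : IsWeight D q Q) {c₀ σ₀ : ℝ} (hc : 0 < c₀) (hσ₀ : 0 < σ₀) {s : ℂ}
    (hs : σ₀ < s.re) {uinc u : L2q D q} (h : IsSolution c₀ s D q uinc u) :
    h2Norm D u ≤ h2Const c₀ Q σ₀ * ‖s‖ ^ 5 * ‖uinc‖ := by
  have hs0 : 0 < s.re := hσ₀.trans hs
  have hκ := re_div_pos hc hs0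
  have hsn : σ₀ ≤ ‖s‖ := hs.le.trans (Complex.re_le_norm s)
  have hsp : 0 < ‖s‖ := hσ₀.trans_le hsn
  have hQ := hw.nonneg
  have hu : u =ᵐ[volume.restrict D]
      resolvent (s / (c₀ : ℂ)) hκ ((s / (c₀ : ℂ)) ^ 2 • hw.densityL2 (uinc - u)) :=
    (hw.solExt_ae_eq_self h).symm.trans (ae_restrict_of_ae (hw.solExt_ae_eq hκ uinc u))
  refine (h2Norm_le_of_ae_eq_resolvent hw.isOpen hκ hu).trans ?_
  have e1 : ‖s / (c₀ : ℂ)‖ / (s / (c₀ : ℂ)).re * (1 + 1 / ‖s / (c₀ : ℂ)‖ ^ 2)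
      ≤ ‖s‖ * (1 / σ₀ * (1 + c₀ ^ 2 / σ₀ ^ 2)) := by
    rw [norm_div, Complex.norm_real, Real.norm_of_nonneg hc.le, Complex.div_ofReal_re]
    calc ‖s‖ / c₀ / (s.re / c₀) * (1 + 1 / (‖s‖ / c₀) ^ 2)
        = ‖s‖ * (1 / s.re * (1 + c₀ ^ 2 / ‖s‖ ^ 2)) := by field_simp
      _ ≤ _ := by gcongr
  have e2 : 1 + Q / s.re ^ 2 * ‖s‖ ^ 2 ≤ (1 + Q) / σ₀ ^ 2 * ‖s‖ ^ 2 := by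
    have h1 : 1 ≤ 1 / σ₀ ^ 2 * ‖s‖ ^ 2 := by
      rw [one_div_mul_eq_div, one_le_div (by positivity)]
      gcongr
    have h2 : Q / s.re ^ 2 * ‖s‖ ^ 2 ≤ Q / σ₀ ^ 2 * ‖s‖ ^ 2 := by gcongr
    calc 1 + Q / s.re ^ 2 * ‖s‖ ^ 2 ≤ 1 / σ₀ ^ 2 * ‖s‖ ^ 2 + Q / σ₀ ^ 2 * ‖s‖ ^ 2 := by
          linarith
      _ = _ := by ring
  calc 4 * (‖s / (c₀ : ℂ)‖ / (s / (c₀ : ℂ)).re * (1 + 1 / ‖s / (c₀ : ℂ)‖ ^ 2)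
        * ‖(s / (c₀ : ℂ)) ^ 2 • hw.densityL2 (uinc - u)‖)
      ≤ 4 * (‖s‖ * (1 / σ₀ * (1 + c₀ ^ 2 / σ₀ ^ 2)) * (‖s‖ ^ 2 / c₀ ^ 2
        * (Real.sqrt Q * (((1 + Q) / σ₀ ^ 2 * ‖s‖ ^ 2) * ‖uinc‖)))) := by
        gcongr
        refine (hw.norm_smul_densityL2_le hc hs0 h).trans ?_
        gcongr
    _ = (h2Const c₀ Q σ₀ - 1) * ‖s‖ ^ 5 * ‖uinc‖ := by rw [h2Const]; ring
    _ ≤ _ := by gcongr; linarith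

end IsWeight

end LippmannSchwinger

theorem mainTheorem6 (c₀ qmax σ₀ : ℝ) (hc₀ : 0 < c₀) (hσ₀ : 0 < σ₀) :
    ∃ C : ℝ, 0 < C ∧
      ∀ (D : Set LippmannSchwinger.R3) (q : LippmannSchwinger.R3 → ℝ),
        IsOpen D → Bornology.IsBounded D →
        AEMeasurable q (volume.restrict D) →
        (∀ᵐ x ∂(volume.restrict D), 0 ≤ q x ∧ q x ≤ qmax) →
        -- `q` is a weight function on `L²(D)`
        (∀ v : LippmannSchwinger.R3 → ℂ, MemLp v 2 (volume.restrict D) →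
          eLpNorm (fun x => (Real.sqrt (q x) : ℂ) * v x) 2 (volume.restrict D) = 0 →
          v =ᵐ[volume.restrict D] 0) →
        ∀ s : ℂ, σ₀ < s.re → ∀ uinc : LippmannSchwinger.L2q D q,
          (∃! u : LippmannSchwinger.L2q D q, LippmannSchwinger.IsSolution c₀ s D q uinc u) ∧
          ∀ u : LippmannSchwinger.L2q D q, LippmannSchwinger.IsSolution c₀ s D q uinc u →
            -- the extension of `u` to the whole space lies in `H¹`
            LippmannSchwinger.solExt c₀ s D q uinc u =ᵐ[volume.restrict D] u ∧
            LippmannSchwinger.MemH1 Set.univ (LippmannSchwinger.solExt c₀ s D q uinc u) ∧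
            -- the bound in the weighted space
            ‖u‖ ≤ qmax / s.re ^ 2 * ‖s‖ ^ 2 * ‖uinc‖ ∧
            -- the `H¹_s` bound on the whole space
            LippmannSchwinger.h1sNorm s Set.univ (LippmannSchwinger.solExt c₀ s D q uinc u)
              ≤ max 1 (1 / c₀) * (‖s‖ ^ 2 / s.re) * Real.sqrt qmax
                * (1 + qmax / s.re ^ 2 * ‖s‖ ^ 2) * ‖uinc‖ ∧
            -- the `H²` bound on `D`
            LippmannSchwinger.MemH2 D u ∧
            LippmannSchwinger.h2Norm D u ≤ C * ‖s‖ ^ 5 * ‖uinc‖ := by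
  -- The sign of `qmax` is not assumed, and the constant must be chosen before D and q. The weight
  -- is thus treated with bound `max qmax 0`; if `qmax` is negative, the norm of `uinc` vanishes,
  -- which settles the bounds stated with `qmax`.
  have hQ : 0 ≤ max qmax 0 := le_max_right _ _
  refine ⟨LippmannSchwinger.IsWeight.h2Const c₀ (max qmax 0) σ₀, ?_, ?_⟩
  · unfold LippmannSchwinger.IsWeight.h2Const
    positivity
  intro D q hD hDb hqm hq hv s hs uinc
  have hw : LippmannSchwinger.IsWeight D q (max qmax 0) :=
    { isOpen := hD
      isBounded := hDb
      aemeasurable := hqm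
      bounds := by
        filter_upwards [hq] with x hx using ⟨hx.1, hx.2.trans (le_max_left _ _)⟩
      nonneg := hQ
      absolutelyContinuous :=
        LippmannSchwinger.restrict_absolutelyContinuous_weightedMeasure hDb hqm hv }
  have hs0 : 0 < s.re := hσ₀.trans hs
  have hκ := LippmannSchwinger.IsWeight.re_div_pos hc₀ hs0
  refine ⟨hw.existsUnique_isSolution hc₀ hs0 uinc, fun u hu => ?_⟩
  have hext := hw.solExt_ae_eq hκ uinc u
  have hself := hw.solExt_ae_eq_self hu
  have hb := hw.norm_le_of_isSolution hc₀ hs0 hu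
  have hb1 := hw.h1sNorm_solExt_le hc₀ hs0 hu
  refine ⟨hself, LippmannSchwinger.memH1_of_ae_eq (ae_restrict_of_ae hext) fun i =>
    LippmannSchwinger.isWeakPartial_resolvent hκ i _, ?_, ?_,
    LippmannSchwinger.memH2_of_ae_eq_resolvent hD hκ
      (hself.symm.trans (ae_restrict_of_ae hext)), hw.h2Norm_le hc₀ hσ₀ hs hu⟩
  · rcases le_or_gt 0 qmax with h | h
    · rwa [max_eq_left h] at hb
    · have h0 := LippmannSchwinger.norm_eq_zero_of_neg hq h uinc
      rw [h0, mul_zero] at hb ⊢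
      exact hb
  · rcases le_or_gt 0 qmax with h | h
    · rwa [max_eq_left h] at hb1
    · have h0 := LippmannSchwinger.norm_eq_zero_of_neg hq h uinc
      rw [h0, mul_zero] at hb1 ⊢
      exact hb1
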